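/- Let $\mathfrak H$ be a real or complex Hilbert space with norm $|\cdot|_2$, and let $\mathcal B(\mathfrak H)$ be the algebra of its bounded operators with the operator norm $\|\cdot\|_2$. Let $I\subset\mathbb R$ be an interval, and let $\phi$ be a countably additive $\mathcal B(\mathfrak H)$-valued Borel measure on $I$ without atoms (that is, $\phi(\{t\})=0$ for every $t\in I$) whose total variation $\int\|\phi\|_2$ is finite. Let \[\operatorname{Lexp}\phi=1+\sum_{n\ge 1}\ \int_{t_1\le\dots\le t_n\in I}\phi(t_n)\cdots\phi(t_1)\] be its left time-ordered exponential. For $x,y\in\mathfrak H$ with $x\ne0$ put \[y:x=\frac{\operatorname{Re}\langle y,x\rangle}{|x|_2^2}+\mathrm i\left|\frac{y}{|x|_2}-\frac{\operatorname{Re}\langle y,x\rangle}{|x|_2^2}\,\frac{x}{|x|_2}\right|_2 ,\] and for $A\in\mathcal B(\mathfrak H)$ let $\operatorname{CR}(A)=\{Ax:x,\ \overline{Ax:x}\ \mid\ x\in\mathfrak H\setminus\{0\}\}$ be its conformal range. If $\mathfrak H$ is real, spectra and spectral radii are taken in the complexification of $\mathcal B(\mathfrak H)$. Write $\overline{\mathrm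 D}(0,r)=\{z\in\mathbb C: |z|\le r\}$. Then \[\operatorname{CR}(\operatorname{Lexp}\phi)\subset\exp\overline{\mathrm D}\bigl(0,\textstyle\int\|\phi\|_2\bigr) \qquad\text{and}\qquad \operatorname{sp}(\operatorname{Lexp}\phi)\subset\exp\overline{\mathrm D}\bigl(0,\textstyle\int\|\phi\|_2\bigr).\] In particular, if $\int\|\phi\|_2<\pi$, then $\log\operatorname{Lexp}\phi$ is well-defined, and its spectral radius is at most $\int\|\phi\|_2$. Here $\log A$ is called well-defined if $(1-t)1+tA$ is invertible for every $t\in[0,1]$, and then \[\log A=\int_0^1 (A-1)\bigl(s+(1-s)A\bigr)^{-1}\,\mathrm ds .\] -/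

import Mathlib

open MeasureTheory Set
open scoped TensorProduct

noncomputable section

/-- The total variation `∫ ‖φ‖ ∈ [0, ∞]` of a measure with values in a normed ring. -/
def totalVariation {α 𝔄 : Type*} [MeasurableSpace α] [NormedRing 𝔄] (φ : VectorMeasure α 𝔄) :
    ENNReal :=
  φ.variation univ

/-- The iterated ordered integrals
`lexpTerm φ n t = ∫_{t₁ ≤ ⋯ ≤ tₙ ≤ t} φ(tₙ) ⋯ φ(t₁)` of an `𝔄`-valued measure `φ` on an ordered
space (later factors stand on the left), computed one variable at a time:
`lexpTerm φ 0 t = 1` and `lexpTerm φ (n + 1) t = ∫_{s ≤ t} φ(ds) (lexpTerm φ n s)`. -/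
def lexpTerm {α 𝔄 : Type*} [Preorder α] [MeasurableSpace α] [NormedRing 𝔄] [NormedAlgebra ℝ 𝔄]
    (φ : VectorMeasure α 𝔄) : ℕ → α → 𝔄
  | 0 => fun _ => 1
  | n + 1 => fun t =>
      (φ.restrict (Iic t)).integral (lexpTerm φ n) (ContinuousLinearMap.mul ℝ 𝔄).flip

/-- The left time-ordered exponential
`Lexp φ = 1 + ∑_{n ≥ 1} ∫_{t₁ ≤ ⋯ ≤ tₙ} φ(tₙ) ⋯ φ(t₁)`. -/
def Lexp {α 𝔄 : Type*} [Preorder α] [MeasurableSpace α] [NormedRing 𝔄] [NormedAlgebra ℝ 𝔄]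
    (φ : VectorMeasure α 𝔄) : 𝔄 :=
  1 + ∑' n : ℕ, φ.integral (lexpTerm φ n) (ContinuousLinearMap.mul ℝ 𝔄).flip

/-- The complex number `y : x` recording the real orthogonal decomposition of `y` with respect to
`x ≠ 0`: its real part is `Re⟪y, x⟫ / ‖x‖²`, its imaginary part is
`‖ y / ‖x‖ - (Re⟪y, x⟫ / ‖x‖²) x / ‖x‖ ‖`. -/
def conformalQuot (𝕜 : Type*) {H : Type*} [RCLike 𝕜] [NormedAddCommGroup H]
    [InnerProductSpace 𝕜 H] (y x : H) : ℂ where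
  re := RCLike.re (inner 𝕜 y x) / ‖x‖ ^ 2
  im := ‖((‖x‖⁻¹ : ℝ) : 𝕜) • y
      - ((RCLike.re (inner 𝕜 y x) / ‖x‖ ^ 2 : ℝ) : 𝕜) • ((‖x‖⁻¹ : ℝ) : 𝕜) • x‖

/-- The conformal range of a bounded operator on a real or complex Hilbert space. -/
def conformalRange {𝕜 H : Type*} [RCLike 𝕜] [NormedAddCommGroup H] [InnerProductSpace 𝕜 H]
    (A : H →L[𝕜] H) : Set ℂ :=
  {z | ∃ x : H, x ≠ 0 ∧
    (z = conformalQuot 𝕜 (A x) x ∨ z = starRingEnd ℂ (conformalQuot 𝕜 (A x) x))}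

/-- `log A` is well-defined: the segment from `1` to `A` consists of invertible elements. -/
def LogWellDefined {𝔄 : Type*} [NormedRing 𝔄] [NormedAlgebra ℝ 𝔄] (A : 𝔄) : Prop :=
  ∀ t ∈ Icc (0 : ℝ) 1, IsUnit ((1 - t) • (1 : 𝔄) + t • A)

/-- The (principal) logarithm
`log A = ∫₀¹ (A - 1) (s + (1 - s) A)⁻¹ ds` of an element of a Banach algebra;
meaningful when `LogWellDefined A` holds. -/
def algLog {𝔄 : Type*} [NormedRing 𝔄] [NormedAlgebra ℝ 𝔄] (A : 𝔄) : 𝔄 :=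
  ∫ s in (0 : ℝ)..1, (A - 1) * Ring.inverse (s • (1 : 𝔄) + (1 - s) • A)

/-- The image of an element of a real algebra in its complexification. The spectrum of an element
of a real algebra is understood to be the spectrum of this image. -/
def complexify {𝔄 : Type*} [Ring 𝔄] [Algebra ℝ 𝔄] (A : 𝔄) : ℂ ⊗[ℝ] 𝔄 :=
  (1 : ℂ) ⊗ₜ[ℝ] A

end

/-! ### Cutting an atomless measure on a set of reals along lower sets. -/

section Partition

/-! Cutting time finely writes `Lexp φ` as a finite product of factors `1 + e` with `e` small and `∑
‖e‖` at most `(1 + ε) ∫‖φ‖` (`exists_list_prod_eq_Lexp`).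

For nonzero vectors, `log (y : x)` has real part `log (‖y‖ / ‖x‖)`, which is additive along chains,
and imaginary part the angle between `x` and `y`, which obeys the triangle inequality. Hence `‖log
(y : x)‖` satisfies a triangle inequality (`norm_log_conformalQuot_triangle`). A factor `1 + e`
moves a vector by at most about `‖e‖` in this sense, so `Lexp φ` moves every vector by at most
`∫‖φ‖`: this is the conformal range bound.

For the spectrum, let `z` lie outside `S = exp (closed disc)`. The quantity `‖z x - s A x‖` is
controlled from below by the distance from `z`, folded into the upper half plane, to `s S`. This
keeps a path of operators from an obviously invertible one to `z - A` bounded below, hence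
invertible (`spectrum_subset_exp_image_closedBall`).

For radius below `π`, the principal logarithm inverts `exp` on the disc, and spectral mapping for
`algLog` gives the last claim. Real spaces are handled by extending operators to `H ⊕ iH`. -/

theorem Real.measure_setOf_measure_Iic_mem_Ioc_le (ν : Measure ℝ) [IsFiniteMeasure ν] [NullSingletonClass ν]
    (a b : ℝ) :
    ν {t : ℝ | a < ν.real (Iic t) ∧ ν.real (Iic t) ≤ b} ≤ ENNReal.ofReal (b - a) := by
  have hmono : Monotone fun t : ℝ => ν.real (Iic t) := fun s t hst =>
    measureReal_mono (Iic_subset_Iic.2 hst)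
  have hmeas : MeasurableSet {t : ℝ | a < ν.real (Iic t) ∧ ν.real (Iic t) ≤ b} :=
    (measurableSet_lt measurable_const hmono.measurable).inter
      (measurableSet_le hmono.measurable measurable_const)
  by_contra! hlt
  -- A compact subset contains its infimum and supremum, so the distribution function at both ends
  -- lies in `(a, b]`, even if the level set itself omits its endpoints.
  obtain ⟨K, hK, hKc, hlt'⟩ := hmeas.exists_lt_isCompact hlt
  have hne : K.Nonempty := by
    by_contra! h
    simp [h] at hlt'
  refine absurd hlt' (not_lt.2 ?_)
  have hsub : K ⊆ Icc (sInf K) (sSup K) := fun x hx =>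
    ⟨csInf_le hKc.bddBelow hx, le_csSup hKc.bddAbove hx⟩
  have h1 := (hK (hKc.sInf_mem hne)).1
  have h2 := (hK (hKc.sSup_mem hne)).2
  have h3 : sInf K ≤ sSup K := csInf_le_csSup hne hKc.bddBelow hKc.bddAbove
  have h4 : ν.real (Iic (sInf K)) + ν.real (Ioc (sInf K) (sSup K)) = ν.real (Iic (sSup K)) := by
    rw [← measureReal_union (by
      rw [Set.disjoint_left]; intro x hx hx'; exact absurd hx'.1 (not_lt.2 hx)) measurableSet_Ioc,
      Iic_union_Ioc_eq_Iic h3]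
  calc ν K ≤ ν (Icc (sInf K) (sSup K)) := measure_mono hsub
    _ = ν (Ioc (sInf K) (sSup K)) := measure_congr Ioc_ae_eq_Icc.symm
    _ = ENNReal.ofReal (ν.real (Ioc (sInf K) (sSup K))) := by
        rw [ofReal_measureReal]
    _ ≤ ENNReal.ofReal (b - a) := ENNReal.ofReal_le_ofReal (by linarith)

/-- A finite atomless measure on a set of reals can be cut along lower sets into pieces
of small measure. -/
theorem exists_lowerSet_partition {I : Set ℝ} (μ : Measure I) [IsFiniteMeasure μ]
    (hμ : ∀ t : I, μ {t} = 0) {δ : ℝ} (hδ : 0 < δ) :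
    ∃ S : ℕ → Set I, S 0 = ∅ ∧ (∃ N, S N = univ) ∧ (∀ k, IsLowerSet (S k)) ∧
      (∀ k, S k ⊆ S (k + 1)) ∧ ∀ k, μ.real (S (k + 1) \ S k) ≤ δ := by
  set ν : Measure ℝ := μ.map Subtype.val with hν
  have hna : NullSingletonClass ν := by
    refine ⟨fun x => ?_⟩
    rw [hν, Measure.map_apply measurable_subtype_coe (measurableSet_singleton x)]
    by_cases hx : x ∈ I
    · rw [show Subtype.val ⁻¹' {x} = {(⟨x, hx⟩ : I)} by ext y; simp [Subtype.ext_iff]]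
      exact hμ _
    · rw [show Subtype.val ⁻¹' {x} = (∅ : Set I) by
        ext y; simp only [mem_preimage, mem_singleton_iff, mem_empty_iff_false, iff_false]
        rintro rfl; exact hx y.2]
      simp
  set F : ℝ → ℝ := fun t => ν.real (Iic t) with hF
  have hmono : Monotone F := fun s t hst => measureReal_mono (Iic_subset_Iic.2 hst)
  have hkey : ∀ a b : ℝ, a ≤ b → μ.real {t : I | a < F t ∧ F t ≤ b} ≤ b - a := by
    intro a b hab
    have h := Real.measure_setOf_measure_Iic_mem_Ioc_le ν a b
    rw [hν, Measure.map_apply measurable_subtype_coe] at h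
    · rw [measureReal_def]
      exact ENNReal.toReal_le_of_le_ofReal (by linarith) h
    · exact (measurableSet_lt measurable_const hmono.measurable).inter
        (measurableSet_le hmono.measurable measurable_const)
  -- Sublevel sets of the distribution function, shifted by one index so that the chain starts at
  -- `∅`. The first increment is `{F ≤ 0}`, bounded below through the window `(-δ, 0]`.
  refine ⟨fun k => Nat.casesOn k ∅ fun k => {t : I | F t ≤ k * δ}, rfl, ?_, ?_, ?_, ?_⟩
  · obtain ⟨N, hN⟩ := exists_nat_gt (ν.real univ / δ)
    refine ⟨N + 1, eq_univ_of_forall fun t => ?_⟩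
    have h1 : F t ≤ ν.real univ := measureReal_mono (subset_univ _)
    have h2 : ν.real univ < N * δ := by rwa [div_lt_iff₀ hδ] at hN
    exact (h1.trans h2.le)
  · rintro (_ | k)
    · exact isLowerSet_empty
    · intro s t hts hs
      exact (hmono (show (t : ℝ) ≤ s from hts)).trans hs
  · rintro (_ | k)
    · exact empty_subset _
    · intro t ht
      have : F t ≤ k * δ := ht
      show F t ≤ ((k + 1 : ℕ) : ℝ) * δ
      push_cast
      nlinarith
  · rintro (_ | k)
    · show μ.real ({t : I | F t ≤ (0 : ℕ) * δ} \ ∅) ≤ δ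
      refine le_trans (measureReal_mono ?_) ((hkey (-δ) 0 (by linarith)).trans (by linarith))
      intro t ht
      refine ⟨lt_of_lt_of_le (by linarith : -δ < 0) measureReal_nonneg, ?_⟩
      simpa using ht.1
    · show μ.real ({t : I | F t ≤ (k + 1 : ℕ) * δ} \ {t : I | F t ≤ k * δ}) ≤ δ
      refine le_trans (measureReal_mono ?_)
        ((hkey (k * δ) ((k + 1 : ℕ) * δ) (by push_cast; nlinarith)).trans
          (by push_cast; linarith))
      rintro t ⟨ht1, ht2⟩
      exact ⟨not_le.1 ht2, ht1⟩

end Partition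

/-! ### The time-ordered exponential as a product of factors near the identity. -/

section OrderedExponential

variable {α 𝔄 : Type*} [MeasurableSpace α] [NormedRing 𝔄] [NormedAlgebra ℝ 𝔄]

theorem ContinuousLinearMap.opNorm_flip_mul_le :
    ‖(ContinuousLinearMap.mul ℝ 𝔄).flip‖ ≤ 1 := by
  rw [ContinuousLinearMap.opNorm_flip]
  exact ContinuousLinearMap.opNorm_mul_le ℝ 𝔄

theorem norm_setIntegral_flip_mul_le (φ : VectorMeasure α 𝔄) [IsFiniteMeasure φ.variation]
    {f : α → 𝔄} {S : Set α} {C : ℝ} (hC : 0 ≤ C) (hf : ∀ x ∈ S, ‖f x‖ ≤ C) :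
    ‖(φ.restrict S).integral f (ContinuousLinearMap.mul ℝ 𝔄).flip‖ ≤ C * φ.variation.real S := by
  refine (VectorMeasure.norm_setIntegral_le_of_norm_le_const hf).trans ?_
  have h := ContinuousLinearMap.opNorm_flip_mul_le (𝔄 := 𝔄)
  have : C * ‖(ContinuousLinearMap.mul ℝ 𝔄).flip‖ ≤ C * 1 := by gcongr
  calc _ ≤ C * 1 * φ.variation.real S := by gcongr
    _ = _ := by rw [mul_one]

variable [LinearOrder α]

/-- The ordered integrals `∫_{t₁ ≤ ⋯ ≤ tₙ ∈ L} φ(tₙ) ⋯ φ(t₁)` over a lower set `L`. -/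
noncomputable def lexpSetTerm (φ : VectorMeasure α 𝔄) : ℕ → Set α → 𝔄
  | 0 => fun _ => 1
  | n + 1 => fun L =>
      (φ.restrict L).integral (lexpTerm φ n) (ContinuousLinearMap.mul ℝ 𝔄).flip

/-- The time-ordered exponential of the restriction of `φ` to a lower set. -/
noncomputable def lexpSet (φ : VectorMeasure α 𝔄) (L : Set α) : 𝔄 :=
  ∑' n, lexpSetTerm φ n L

theorem lexpTerm_eq_lexpSetTerm (φ : VectorMeasure α 𝔄) (n : ℕ) (t : α) :
    lexpTerm φ n t = lexpSetTerm φ n (Iic t) := by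
  cases n <;> rfl

variable [TopologicalSpace α] [OrderClosedTopology α] [OpensMeasurableSpace α]

theorem IsLowerSet.measurableSet_of_linearOrder {L : Set α} (hL : IsLowerSet L) :
    MeasurableSet L :=
  hL.ordConnected.measurableSet

/-- The indefinite integral is Lipschitz with respect to the real monotone function `t ↦
φ.variation.real (Iic t)`, so it factors continuously through a subset of `ℝ`. This gives strong
measurability without separability of `𝔄`. -/
theorem stronglyMeasurable_setIntegral_Iic [BorelSpace α] (φ : VectorMeasure α 𝔄)
    [IsFiniteMeasure φ.variation] {f : α → 𝔄} {C : ℝ} (hC : 0 ≤ C) (hf : ∀ x, ‖f x‖ ≤ C)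
    (hfi : φ.Integrable f) :
    StronglyMeasurable fun t =>
      (φ.restrict (Iic t)).integral f (ContinuousLinearMap.mul ℝ 𝔄).flip := by
  set g : α → 𝔄 := fun t =>
    (φ.restrict (Iic t)).integral f (ContinuousLinearMap.mul ℝ 𝔄).flip with hg
  set F : α → ℝ := fun t => φ.variation.real (Iic t) with hF
  have hmono : Monotone F := fun s t hst => measureReal_mono (Iic_subset_Iic.2 hst)
  have hle : ∀ s t, s ≤ t → ‖g t - g s‖ ≤ C * |F t - F s| := by
    intro s t hst
    rw [hg]
    simp only
    rw [← VectorMeasure.setIntegral_sdiff measurableSet_Iic measurableSet_Iic hfi.integrableOn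
      (Iic_subset_Iic.2 hst)]
    refine (norm_setIntegral_flip_mul_le φ hC fun x _ => hf x).trans ?_
    rw [measureReal_sdiff (Iic_subset_Iic.2 hst) measurableSet_Iic]
    gcongr
    exact le_abs_self _
  have hlip : ∀ s t, dist (g s) (g t) ≤ C * dist (F s) (F t) := by
    intro s t
    rcases le_total s t with h | h
    · rw [dist_comm, dist_comm (F s), dist_eq_norm, Real.dist_eq]; exact hle s t h
    · rw [dist_eq_norm, Real.dist_eq]; exact hle t s h
  -- The chosen preimage is immaterial: by `hlip`, equal values of `F` force equal values of `g`.
  let G : range F → 𝔄 := fun y => g (rangeSplitting F y)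
  have hG : LipschitzWith C.toNNReal G := by
    refine LipschitzWith.of_dist_le_mul fun x y => ?_
    refine (hlip _ _).trans ?_
    rw [apply_rangeSplitting F, apply_rangeSplitting F, Real.coe_toNNReal _ hC]
    rfl
  have hgG : g = G ∘ rangeFactorization F := by
    ext1 t
    refine eq_of_dist_eq_zero (le_antisymm ((hlip _ _).trans ?_) dist_nonneg)
    rw [apply_rangeSplitting F]
    simp [rangeFactorization]
  rw [hgG]
  exact hG.continuous.stronglyMeasurable.comp_measurable
    (hmono.measurable.subtype_mk)

end OrderedExponential

section OrderedExponentialPartition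

variable {α 𝔄 : Type*} [MeasurableSpace α] [NormedRing 𝔄] [NormedAlgebra ℝ 𝔄] [LinearOrder α]
  [TopologicalSpace α] [OrderClosedTopology α] [BorelSpace α]

theorem stronglyMeasurable_lexpTerm (φ : VectorMeasure α 𝔄) [IsFiniteMeasure φ.variation] (n : ℕ) :
    StronglyMeasurable (lexpTerm φ n) ∧ ∃ C : ℝ, 0 ≤ C ∧ ∀ t, ‖lexpTerm φ n t‖ ≤ C := by
  induction n with
  | zero => exact ⟨stronglyMeasurable_const, ‖(1 : 𝔄)‖, norm_nonneg _, fun t => le_rfl⟩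
  | succ n ih =>
    obtain ⟨hm, C, hC, hb⟩ := ih
    have hint : φ.Integrable (lexpTerm φ n) :=
      Integrable.of_bound hm.aestronglyMeasurable C (Filter.Eventually.of_forall hb)
    refine ⟨stronglyMeasurable_setIntegral_Iic φ hC hb hint, C * φ.variation.real univ,
      by positivity, fun t => ?_⟩
    refine (norm_setIntegral_flip_mul_le φ hC fun x _ => hb x).trans ?_
    gcongr
    · finiteness
    · exact subset_univ _

theorem integrable_lexpTerm (φ : VectorMeasure α 𝔄) [IsFiniteMeasure φ.variation] (n : ℕ) :
    φ.Integrable (lexpTerm φ n) := by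
  obtain ⟨hm, C, hC, hb⟩ := stronglyMeasurable_lexpTerm φ n
  exact Integrable.of_bound hm.aestronglyMeasurable C (Filter.Eventually.of_forall hb)

/-- Splitting off the last piece gives a recursion `a (k+1) (n+1) ≤ a k (n+1) + δ * a (k+1) n`,
which `2 ^ k * (2 * δ) ^ n` solves with equality. For `δ < 1/2` this is geometric decay in `n`,
enough for summability. -/
theorem norm_lexpSetTerm_le_of_partition (φ : VectorMeasure α 𝔄) [IsFiniteMeasure φ.variation]
    (h1 : ‖(1 : 𝔄)‖ ≤ 1) {δ : ℝ} (hδ : 0 ≤ δ) {S : ℕ → Set α} (h0 : S 0 = ∅)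
    (hlow : ∀ k, IsLowerSet (S k))
    (hS : ∀ k, φ.variation.real (S (k + 1) \ S k) ≤ δ) (k n : ℕ) {L : Set α} (hL : IsLowerSet L)
    (hLS : L ⊆ S k) : ‖lexpSetTerm φ n L‖ ≤ 2 ^ k * (2 * δ) ^ n := by
  induction k generalizing n L with
  | zero =>
    rw [h0, subset_empty_iff] at hLS
    subst hLS
    cases n with
    | zero => simpa [lexpSetTerm] using h1
    | succ n =>
      simp only [lexpSetTerm, VectorMeasure.setIntegral_empty, norm_zero]
      positivity
  | succ k ihk =>
    induction n generalizing L with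
    | zero =>
      simp only [lexpSetTerm, pow_zero, mul_one]
      exact h1.trans (one_le_pow₀ (by norm_num))
    | succ n ihn =>
      have hLm := hL.measurableSet_of_linearOrder
      have hSm := (hlow k).measurableSet_of_linearOrder
      have hsplit : lexpSetTerm φ (n + 1) L = lexpSetTerm φ (n + 1) (L ∩ S k) +
          (φ.restrict (L \ S k)).integral (lexpTerm φ n) (ContinuousLinearMap.mul ℝ 𝔄).flip :=
        (VectorMeasure.setIntegral_inter_add_sdiff hLm hSm
          (integrable_lexpTerm φ n).integrableOn).symm
      have hA := ihk (n + 1) (hL.inter (hlow k)) inter_subset_right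
      have hB := norm_setIntegral_flip_mul_le φ (f := lexpTerm φ n) (S := L \ S k)
        (C := 2 ^ (k + 1) * (2 * δ) ^ n) (by positivity) (fun x hx => by
          rw [lexpTerm_eq_lexpSetTerm]
          exact ihn (isLowerSet_Iic x) (fun y hy => hLS (hL hy hx.1)))
      have hC : φ.variation.real (L \ S k) ≤ δ :=
        (measureReal_mono (sdiff_subset_sdiff_left hLS)).trans (hS k)
      rw [hsplit]
      calc _ ≤ 2 ^ k * (2 * δ) ^ (n + 1) + 2 ^ (k + 1) * (2 * δ) ^ n * δ :=
            (norm_add_le _ _).trans (add_le_add hA (hB.trans (by gcongr)))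
        _ = _ := by ring

variable (φ : VectorMeasure α 𝔄) [IsFiniteMeasure φ.variation] [CompleteSpace 𝔄] {C : ℝ}
  (hb : ∀ n (L : Set α), IsLowerSet L → ‖lexpSetTerm φ n L‖ ≤ C * (1 / 2) ^ n)

include hb

theorem summable_lexpSetTerm {L : Set α} (hL : IsLowerSet L) :
    Summable fun n => lexpSetTerm φ n L :=
  Summable.of_norm_bounded (summable_geometric_two.mul_left C) fun n => hb n L hL

theorem hasSum_lexpSet {L : Set α} (hL : IsLowerSet L) :
    HasSum (fun n => lexpSetTerm φ n L) (lexpSet φ L) :=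
  (summable_lexpSetTerm φ hb hL).hasSum

theorem norm_lexpSet_le {L : Set α} (hL : IsLowerSet L) : ‖lexpSet φ L‖ ≤ C * 2 := by
  refine (tsum_of_norm_bounded (summable_geometric_two.hasSum.mul_left C) fun n => hb n L hL).trans ?_
  rw [tsum_geometric_two]

theorem integrable_lexpSet_Iic : φ.Integrable fun t => lexpSet φ (Iic t) := by
  refine Integrable.of_bound (C := C * 2) ?_
    (Filter.Eventually.of_forall fun t => norm_lexpSet_le φ hb (isLowerSet_Iic t))
  refine (stronglyMeasurable_of_tendsto (f := fun (n : ℕ) t => ∑ i ∈ Finset.range n, lexpTerm φ i t)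
    Filter.atTop (fun n => ?_) ?_).aestronglyMeasurable
  · exact Finset.stronglyMeasurable_fun_sum _ fun i _ => (stronglyMeasurable_lexpTerm φ i).1
  · rw [tendsto_pi_nhds]
    intro t
    simp only [lexpTerm_eq_lexpSetTerm]
    exact (hasSum_lexpSet φ hb (isLowerSet_Iic t)).tendsto_sum_nat

/-- The Volterra equation `dE = φ E`: the constant terms cancel, and dominated convergence exchanges
the sum over `n` with the integral. -/
theorem lexpSet_sub_lexpSet {L M : Set α} (hL : IsLowerSet L) (hM : IsLowerSet M) (hLM : L ⊆ M) :
    lexpSet φ M - lexpSet φ L = (φ.restrict (M \ L)).integral (fun t => lexpSet φ (Iic t))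
      (ContinuousLinearMap.mul ℝ 𝔄).flip := by
  have hLm := hL.measurableSet_of_linearOrder
  have hMm := hM.measurableSet_of_linearOrder
  have h1 := (hasSum_lexpSet φ hb hM).sub (hasSum_lexpSet φ hb hL)
  rw [← hasSum_nat_add_iff' 1] at h1
  simp only [Finset.range_one, Finset.sum_singleton] at h1
  rw [show lexpSetTerm φ 0 M - lexpSetTerm φ 0 L = 0 from sub_self _, sub_zero] at h1
  have hfin : IsFiniteMeasure (φ.restrict (M \ L)).variation := by
    rw [VectorMeasure.variation_restrict (hMm.diff hLm)]; infer_instance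
  have h2 : HasSum (fun n => (φ.restrict (M \ L)).integral (lexpTerm φ n)
      (ContinuousLinearMap.mul ℝ 𝔄).flip) ((φ.restrict (M \ L)).integral
        (fun t => lexpSet φ (Iic t)) (ContinuousLinearMap.mul ℝ 𝔄).flip) := by
    refine VectorMeasure.hasSum_integral_of_dominated_convergence (fun n _ => C * (1 / 2) ^ n)
      (fun n => (stronglyMeasurable_lexpTerm φ n).1.aestronglyMeasurable)
      (fun n => Filter.Eventually.of_forall fun t => ?_)
      (Filter.Eventually.of_forall fun t => summable_geometric_two.mul_left C)
      (integrable_const _) (Filter.Eventually.of_forall fun t => ?_)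
    · rw [lexpTerm_eq_lexpSetTerm]
      exact hb n _ (isLowerSet_Iic t)
    · simp only [lexpTerm_eq_lexpSetTerm]
      exact hasSum_lexpSet φ hb (isLowerSet_Iic t)
  have h3 : (fun n => lexpSetTerm φ (n + 1) M - lexpSetTerm φ (n + 1) L) =
      fun n => (φ.restrict (M \ L)).integral (lexpTerm φ n) (ContinuousLinearMap.mul ℝ 𝔄).flip :=
    funext fun n => (VectorMeasure.setIntegral_sdiff hMm hLm
      (integrable_lexpTerm φ n).integrableOn hLM).symm
  exact h1.unique (h3 ▸ h2)

theorem lexpSet_empty : lexpSet φ ∅ = 1 := by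
  have h : ∀ n, lexpSetTerm φ (n + 1) ∅ = 0 := fun n => VectorMeasure.setIntegral_empty
  have h1 := (hasSum_nat_add_iff' 1).2 (hasSum_lexpSet φ hb (isLowerSet_empty (α := α)))
  simp only [h, Finset.range_one, Finset.sum_singleton] at h1
  exact sub_eq_zero.1 (h1.unique hasSum_zero)

theorem lexpSet_univ : lexpSet φ univ = Lexp φ := by
  rw [lexpSet, (summable_lexpSetTerm φ hb isLowerSet_univ).tsum_eq_zero_add, Lexp]
  simp only [lexpSetTerm, VectorMeasure.restrict_univ]

theorem lexpSet_sub_lexpSet_mul {L M : Set α} (hL : IsLowerSet L) (hM : IsLowerSet M)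
    (hLM : L ⊆ M) (v : 𝔄) :
    lexpSet φ M * v - lexpSet φ L * v = (φ.restrict (M \ L)).integral
      (fun t => lexpSet φ (Iic t) * v) (ContinuousLinearMap.mul ℝ 𝔄).flip := by
  have hmeas := hM.measurableSet_of_linearOrder.diff hL.measurableSet_of_linearOrder
  have hint : Integrable (fun t => lexpSet φ (Iic t)) (φ.restrict (M \ L)).variation :=
    (integrable_lexpSet_Iic φ hb).integrableOn
  have h1 := VectorMeasure.continuousLinearMap_apply_integral (B := (ContinuousLinearMap.mul ℝ 𝔄).flip)
    (C := (ContinuousLinearMap.mul ℝ 𝔄).flip v) hint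
  have h2 := VectorMeasure.integral_continuousLinearMap_comp
    (B := (ContinuousLinearMap.mul ℝ 𝔄).flip) (C := (ContinuousLinearMap.mul ℝ 𝔄).flip v) hint
  simp only [ContinuousLinearMap.flip_apply, ContinuousLinearMap.mul_apply'] at h1 h2
  rw [← sub_mul, lexpSet_sub_lexpSet φ hb hL hM hLM, h1, h2]
  congr 1
  ext x y
  simp [mul_assoc]

/-- A Gronwall argument. With `E = lexpSet φ`, the supremum `K` of `‖E(P) E(L)⁻¹‖` over lower sets
`L ⊆ P ⊆ M` satisfies `K ≤ 1 + K δ` by the Volterra equation, so `K ≤ 1 / (1 - δ)`; the increment is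
then at most `K δ`. -/
theorem exists_lexpSet_eq_one_add_mul (h1 : ‖(1 : 𝔄)‖ ≤ 1) {L M : Set α} (hL : IsLowerSet L)
    (hM : IsLowerSet M) (hLM : L ⊆ M) (hlt : φ.variation.real (M \ L) < 1)
    (hu : IsUnit (lexpSet φ L)) :
    ∃ e : 𝔄, lexpSet φ M = (1 + e) * lexpSet φ L ∧
      ‖e‖ ≤ φ.variation.real (M \ L) / (1 - φ.variation.real (M \ L)) := by
  obtain ⟨u, hu⟩ := hu
  set v : 𝔄 := ↑u⁻¹ with hv
  have huv : lexpSet φ L * v = 1 := by rw [← hu, hv]; simp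
  have hvu : v * lexpSet φ L = 1 := by rw [← hu, hv]; simp
  set δ := φ.variation.real (M \ L) with hδ
  have hδ0 : 0 ≤ δ := measureReal_nonneg
  let T : Set ℝ := (fun P => ‖lexpSet φ P * v‖) '' {P | IsLowerSet P ∧ L ⊆ P ∧ P ⊆ M}
  have hTb : BddAbove T := by
    refine ⟨C * 2 * ‖v‖, ?_⟩
    rintro _ ⟨P, ⟨hP, _, _⟩, rfl⟩
    refine (norm_mul_le _ _).trans ?_
    gcongr
    exact norm_lexpSet_le φ hb hP
  have hTn : (‖lexpSet φ L * v‖) ∈ T := ⟨L, ⟨hL, Subset.rfl, hLM⟩, rfl⟩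
  set K := sSup T with hK
  have hK0 : 0 ≤ K := (norm_nonneg _).trans (le_csSup hTb hTn)
  have hmain : ∀ P, IsLowerSet P → L ⊆ P → P ⊆ M → ‖lexpSet φ P * v - 1‖ ≤ K * δ := by
    intro P hP hLP hPM
    rw [← huv, lexpSet_sub_lexpSet_mul φ hb hL hP hLP]
    refine (norm_setIntegral_flip_mul_le φ hK0 fun x hx => le_csSup hTb
      ⟨Iic x, ⟨isLowerSet_Iic x, fun y hy => ?_, fun y hy => hPM (hP hy hx.1)⟩, rfl⟩).trans ?_
    · by_contra hxy
      exact hx.2 (hL (not_le.1 hxy).le hy)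
    · have : φ.variation.real (P \ L) ≤ δ := measureReal_mono (sdiff_subset_sdiff_left hPM)
      gcongr
  have hKle : K ≤ 1 + K * δ := by
    refine csSup_le ⟨_, hTn⟩ ?_
    rintro _ ⟨P, ⟨hP, hLP, hPM⟩, rfl⟩
    have h := hmain P hP hLP hPM
    calc ‖lexpSet φ P * v‖ = ‖1 + (lexpSet φ P * v - 1)‖ := by rw [add_sub_cancel]
      _ ≤ _ := (norm_add_le _ _).trans (add_le_add h1 h)
  have hK1 : K ≤ 1 / (1 - δ) := by
    rw [le_div_iff₀ (by linarith)]; linarith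
  refine ⟨lexpSet φ M * v - 1, ?_, (hmain M hM hLM Subset.rfl).trans ?_⟩
  · rw [add_sub_cancel, mul_assoc, hvu, mul_one]
  · calc K * δ ≤ 1 / (1 - δ) * δ := by gcongr
      _ = _ := by ring

end OrderedExponentialPartition

/-- The time-ordered exponential of an atomless measure is a finite product of factors `1 + e`
with `e` small and with the sum of the norms nearly bounded by the total variation. -/
theorem exists_list_prod_eq_Lexp {I : Set ℝ} {𝔄 : Type*} [NormedRing 𝔄] [NormedAlgebra ℝ 𝔄]
    [CompleteSpace 𝔄] (h1 : ‖(1 : 𝔄)‖ ≤ 1) (φ : VectorMeasure I 𝔄) (hφ : totalVariation φ < ⊤)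
    (hatom : ∀ t : I, φ {t} = 0) {ε : ℝ} (hε : 0 < ε) :
    ∃ l : List 𝔄, (∀ e ∈ l, ‖e‖ ≤ ε) ∧
      (l.map norm).sum ≤ (1 + ε) * (totalVariation φ).toReal ∧
      (l.map fun e => 1 + e).prod = Lexp φ := by
  wlog hε1 : ε < 1 generalizing ε
  · obtain ⟨l, hl1, hl2, hl3⟩ := this (ε := 1 / 2) (by norm_num) (by norm_num)
    refine ⟨l, fun e he => (hl1 e he).trans (by linarith), hl2.trans ?_, hl3⟩
    gcongr
    linarith
  have hfin : IsFiniteMeasure φ.variation := ⟨hφ⟩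
  have hatom' : ∀ t : I, φ.variation {t} = 0 := fun t => by
    rw [VectorMeasure.variation_apply_eq_zero (measurableSet_singleton t)]
    intro s hs _
    rcases subset_singleton_iff_eq.1 hs with rfl | rfl
    · simp
    · exact hatom t
  obtain ⟨C, hb⟩ : ∃ C : ℝ, ∀ n (L : Set I), IsLowerSet L →
      ‖lexpSetTerm φ n L‖ ≤ C * (1 / 2) ^ n := by
    -- This coarse partition serves only convergence of the series: mesh `1/4` gives ratio `1/2`.
    obtain ⟨S, h0, ⟨N, hN⟩, hlow, -, hS⟩ :=
      exists_lowerSet_partition φ.variation hatom' (δ := 1 / 4) (by norm_num)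
    refine ⟨2 ^ N, fun n L hL => ?_⟩
    convert norm_lexpSetTerm_le_of_partition φ h1 (by norm_num) h0 hlow hS N n hL
      (by rw [hN]; exact subset_univ _) using 3
    norm_num
  -- Chosen so that `1 / (1 - δ) = 1 + ε` and `δ * (1 + ε) = ε`: the first controls the sum of the
  -- norms, the second each single norm.
  set δ := ε / (1 + ε) with hδ
  have hδ0 : 0 < δ := by positivity
  obtain ⟨S, h0, ⟨N, hN⟩, hlow, hmono, hS⟩ := exists_lowerSet_partition φ.variation hatom' hδ0
  have hδe : δ * (1 + ε) = ε := by rw [hδ]; field_simp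
  have hδ1 : δ < 1 := by nlinarith
  have hinv : 1 / (1 - δ) = 1 + ε := by
    rw [div_eq_iff (by linarith)]; linarith
  have key : ∀ k, IsUnit (lexpSet φ (S k)) ∧ ∃ l : List 𝔄, (∀ e ∈ l, ‖e‖ ≤ ε) ∧
      (l.map norm).sum ≤ (1 + ε) * φ.variation.real (S k) ∧
      (l.map fun e => 1 + e).prod = lexpSet φ (S k) := by
    intro k
    induction k with
    | zero =>
      rw [h0, lexpSet_empty φ hb]
      exact ⟨isUnit_one, [], by simp, by simp, by simp⟩
    | succ k ih =>
      obtain ⟨hu, l, hl1, hl2, hl3⟩ := ih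
      have hk := hS k
      obtain ⟨e, he, hen⟩ := exists_lexpSet_eq_one_add_mul φ hb h1 (hlow k) (hlow (k + 1))
        (hmono k) (hk.trans_lt hδ1) hu
      set d := φ.variation.real (S (k + 1) \ S k) with hd
      have hd0 : 0 ≤ d := measureReal_nonneg
      have hen' : ‖e‖ ≤ (1 + ε) * d := by
        refine hen.trans ?_
        rw [← hinv, one_div, div_eq_inv_mul]
        gcongr
      have heε : ‖e‖ ≤ ε := hen'.trans (by nlinarith)
      have hdiff : d = φ.variation.real (S (k + 1)) - φ.variation.real (S k) :=
        measureReal_sdiff (hmono k) (hlow k).measurableSet_of_linearOrder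
      refine ⟨?_, e :: l, ?_, ?_, ?_⟩
      · rw [he]
        refine IsUnit.mul ?_ hu
        have := isUnit_one_sub_of_norm_lt_one (x := -e) (by rw [norm_neg]; linarith)
        rwa [sub_neg_eq_add] at this
      · simp only [List.mem_cons, forall_eq_or_imp]
        exact ⟨heε, hl1⟩
      · simp only [List.map_cons, List.sum_cons]
        nlinarith
      · simp only [List.map_cons, List.prod_cons, hl3, he]
  obtain ⟨-, l, hl1, hl2, hl3⟩ := key N
  rw [hN] at hl2 hl3
  exact ⟨l, hl1, hl2, by rw [hl3, lexpSet_univ φ hb]⟩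

/-! ### Conformal quotients and the logarithmic displacement of vectors. -/

section ConformalGeometry

variable {V : Type*} [NormedAddCommGroup V] [InnerProductSpace ℝ V]

/-- The component of `y / ‖x‖` orthogonal to `x`. -/
noncomputable def conformalOrth (x y : V) : V :=
  ‖x‖⁻¹ • y - (inner ℝ y x / ‖x‖ ^ 2) • ‖x‖⁻¹ • x

theorem conformalQuot_re (y x : V) : (conformalQuot ℝ y x).re = inner ℝ y x / ‖x‖ ^ 2 := rfl

theorem conformalQuot_im (y x : V) : (conformalQuot ℝ y x).im = ‖conformalOrth x y‖ := rfl

theorem conformalOrth_sub (x y z : V) :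
    conformalOrth x (y - z) = conformalOrth x y - conformalOrth x z := by
  simp only [conformalOrth, inner_sub_left, sub_div, smul_sub, sub_smul]
  abel

theorem sq_add_sq_norm_conformalOrth {x : V} (hx : x ≠ 0) (y : V) :
    (inner ℝ y x / ‖x‖ ^ 2) ^ 2 + ‖conformalOrth x y‖ ^ 2 = (‖y‖ / ‖x‖) ^ 2 := by
  have hn : ‖x‖ ≠ 0 := norm_ne_zero_iff.2 hx
  rw [conformalOrth, norm_sub_sq_real]
  simp only [inner_smul_left, inner_smul_right, norm_smul, norm_inv, norm_div, norm_pow,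
    Real.norm_eq_abs, abs_norm, mul_pow, div_pow, sq_abs, map_inv₀, conj_trivial]
  field_simp
  ring

theorem norm_conformalQuot {x : V} (hx : x ≠ 0) (y : V) :
    ‖conformalQuot ℝ y x‖ = ‖y‖ / ‖x‖ := by
  rw [← sq_eq_sq₀ (norm_nonneg _) (by positivity), Complex.sq_norm, Complex.normSq_apply,
    conformalQuot_re, conformalQuot_im, ← sq_add_sq_norm_conformalOrth hx]
  ring

/-- The real part is linear in `y`, the imaginary part is the norm of a linear function of `y`; the
reverse triangle inequality and Pythagoras give the contraction. -/
theorem norm_conformalQuot_sub_le {x : V} (hx : x ≠ 0) (y z : V) :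
    ‖conformalQuot ℝ y x - conformalQuot ℝ z x‖ ≤ ‖y - z‖ / ‖x‖ := by
  rw [← sq_le_sq₀ (norm_nonneg _) (by positivity), Complex.sq_norm, Complex.normSq_apply,
    Complex.sub_re, Complex.sub_im, conformalQuot_re, conformalQuot_im, conformalQuot_re,
    conformalQuot_im, ← sq_add_sq_norm_conformalOrth hx, conformalOrth_sub, inner_sub_left, sub_div]
  have h := abs_norm_sub_norm_le (conformalOrth x y) (conformalOrth x z)
  have h' := pow_le_pow_left₀ (abs_nonneg _) h 2
  rw [sq_abs] at h'
  nlinarith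

theorem conformalQuot_self {x : V} (hx : x ≠ 0) : conformalQuot ℝ x x = 1 := by
  have hn : ‖x‖ ≠ 0 := norm_ne_zero_iff.2 hx
  apply Complex.ext
  · rw [conformalQuot_re, real_inner_self_eq_norm_sq]
    simp [hn]
  · rw [conformalQuot_im, conformalOrth, real_inner_self_eq_norm_sq, div_self (by positivity)]
    simp

theorem conformalQuot_eq {x y : V} (hx : x ≠ 0) (hy : y ≠ 0) :
    conformalQuot ℝ y x = ((‖y‖ / ‖x‖ : ℝ) : ℂ) *
      (Complex.cos (InnerProductGeometry.angle y x) +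
        Complex.sin (InnerProductGeometry.angle y x) * Complex.I) := by
  have hn : ‖x‖ ≠ 0 := norm_ne_zero_iff.2 hx
  have hm : ‖y‖ ≠ 0 := norm_ne_zero_iff.2 hy
  have hre : inner ℝ y x / ‖x‖ ^ 2 = ‖y‖ / ‖x‖ * Real.cos (InnerProductGeometry.angle y x) := by
    rw [InnerProductGeometry.cos_angle]
    field_simp
  have him : ‖conformalOrth x y‖ = ‖y‖ / ‖x‖ * Real.sin (InnerProductGeometry.angle y x) := by
    rw [← sq_eq_sq₀ (norm_nonneg _)
      (mul_nonneg (by positivity) (InnerProductGeometry.sin_angle_nonneg y x))]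
    have h := sq_add_sq_norm_conformalOrth hx y
    rw [hre] at h
    linear_combination h - (‖y‖ / ‖x‖) ^ 2 *
      Real.sin_sq_add_cos_sq (InnerProductGeometry.angle y x)
  rw [← Complex.ofReal_cos, ← Complex.ofReal_sin]
  apply Complex.ext
  · rw [conformalQuot_re, hre, Complex.re_ofReal_mul, Complex.add_re, Complex.re_ofReal_mul,
      Complex.I_re, mul_zero, add_zero, Complex.ofReal_re]
  · rw [conformalQuot_im, him, Complex.im_ofReal_mul, Complex.add_im, Complex.im_ofReal_mul,
      Complex.I_im, mul_one, Complex.ofReal_im, zero_add]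

theorem log_conformalQuot_re {x : V} (hx : x ≠ 0) (y : V) :
    (Complex.log (conformalQuot ℝ y x)).re = Real.log (‖y‖ / ‖x‖) := by
  rw [Complex.log_re, norm_conformalQuot hx]

theorem log_conformalQuot_im {x y : V} (hx : x ≠ 0) (hy : y ≠ 0) :
    (Complex.log (conformalQuot ℝ y x)).im = InnerProductGeometry.angle y x := by
  rw [Complex.log_im, conformalQuot_eq hx hy, Complex.arg_mul_cos_add_sin_mul_I
    (div_pos (norm_pos_iff.2 hy) (norm_pos_iff.2 hx))]
  exact ⟨(neg_lt_zero.2 Real.pi_pos).trans_le (InnerProductGeometry.angle_nonneg y x),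
    InnerProductGeometry.angle_le_pi y x⟩

/-- The logarithms of length ratios add exactly, and the angle from `x` to `z` is at most the sum of
the two others. Angles being nonnegative, this compares moduli. -/
theorem norm_log_conformalQuot_triangle {x y z : V} (hx : x ≠ 0) (hy : y ≠ 0) (hz : z ≠ 0) :
    ‖Complex.log (conformalQuot ℝ z x)‖ ≤
      ‖Complex.log (conformalQuot ℝ y x)‖ + ‖Complex.log (conformalQuot ℝ z y)‖ := by
  refine le_trans ?_ (norm_add_le _ _)
  have hx' := norm_ne_zero_iff.2 hx
  have hy' := norm_ne_zero_iff.2 hy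
  have hz' := norm_ne_zero_iff.2 hz
  rw [← sq_le_sq₀ (norm_nonneg _) (norm_nonneg _), Complex.sq_norm, Complex.sq_norm,
    Complex.normSq_apply, Complex.normSq_apply, Complex.add_re, Complex.add_im,
    log_conformalQuot_re hx, log_conformalQuot_re hx, log_conformalQuot_re hy,
    log_conformalQuot_im hx hy, log_conformalQuot_im hx hz, log_conformalQuot_im hy hz,
    Real.log_div hy' hx', Real.log_div hz' hy', Real.log_div hz' hx']
  have h1 := InnerProductGeometry.angle_le_angle_add_angle z y x
  have h2 := InnerProductGeometry.angle_nonneg z x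
  nlinarith

theorem norm_log_one_add_le_of_le {w : ℂ} {a ε : ℝ} (hw : ‖w‖ ≤ a) (ha : a ≤ ε) (hε : ε ≤ 1 / 2) :
    ‖Complex.log (1 + w)‖ ≤ (1 + ε) * a := by
  have h0 := norm_nonneg w
  have h1 : (1 - ‖w‖)⁻¹ ≤ 2 := by
    rw [inv_le_comm₀ (by linarith) (by norm_num)]
    linarith
  refine (Complex.norm_log_one_add_le (by linarith)).trans ?_
  have h2 : ‖w‖ ^ 2 * (1 - ‖w‖)⁻¹ ≤ ‖w‖ ^ 2 * 2 := by gcongr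
  nlinarith

variable {𝕜 𝔄 : Type*} [NormedField 𝕜] [NormedSpace 𝕜 V] [NormedRing 𝔄]

/-- The logarithmic displacement of a vector by a product of operators near the identity. -/
theorem norm_log_conformalQuot_list_prod_le (ρ : 𝔄 →+* (V →L[𝕜] V))
    (hρ : ∀ a v, ‖ρ a v‖ ≤ ‖a‖ * ‖v‖) {ε : ℝ} (hε : ε ≤ 1 / 2) (l : List 𝔄)
    (hl : ∀ e ∈ l, ‖e‖ ≤ ε) {x : V} (hx : x ≠ 0) :
    ρ (l.map fun e => 1 + e).prod x ≠ 0 ∧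
      ‖Complex.log (conformalQuot ℝ (ρ (l.map fun e => 1 + e).prod x) x)‖ ≤
        (1 + ε) * (l.map norm).sum := by
  induction l with
  | nil => simp [conformalQuot_self hx, hx]
  | cons e l ih =>
    simp only [List.mem_cons, forall_eq_or_imp] at hl
    obtain ⟨hne, hle⟩ := ih hl.2
    set y := ρ (l.map fun e => 1 + e).prod x with hy
    have hz : ρ ((e :: l).map fun e => 1 + e).prod x = y + ρ e y := by
      simp [hy]
    rw [hz]
    have hny := norm_pos_iff.2 hne
    have hey : ‖ρ e y‖ / ‖y‖ ≤ ‖e‖ := by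
      rw [div_le_iff₀ hny]; exact hρ e y
    have hz0 : y + ρ e y ≠ 0 := by
      intro h0
      have h1 : ‖ρ e y‖ = ‖y‖ := by rw [← norm_neg, ← eq_neg_of_add_eq_zero_left h0]
      rw [h1, div_self hny.ne'] at hey
      linarith [hl.1]
    refine ⟨hz0, (norm_log_conformalQuot_triangle hx hne hz0).trans ?_⟩
    -- Contraction, applied against `y : y = 1`.
    have hw : ‖conformalQuot ℝ (y + ρ e y) y - 1‖ ≤ ‖e‖ := by
      rw [← conformalQuot_self hne]
      refine (norm_conformalQuot_sub_le hne _ _).trans ?_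
      rwa [add_sub_cancel_left]
    have h := norm_log_one_add_le_of_le hw hl.1 hε
    rw [add_sub_cancel] at h
    simp only [List.map_cons, List.sum_cons]
    linarith

/-- The product bound with `ε → 0`. The contractive representation `ρ` lets one proof serve both
operators on `H` and real operators acting on the complexification. -/
theorem norm_log_conformalQuot_Lexp_le [NormedAlgebra ℝ 𝔄] [CompleteSpace 𝔄] {I : Set ℝ}
    (h1 : ‖(1 : 𝔄)‖ ≤ 1) (φ : VectorMeasure I 𝔄) (hφ : totalVariation φ < ⊤)
    (hatom : ∀ t : I, φ {t} = 0) (ρ : 𝔄 →+* (V →L[𝕜] V)) (hρ : ∀ a v, ‖ρ a v‖ ≤ ‖a‖ * ‖v‖)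
    {x : V} (hx : x ≠ 0) :
    ρ (Lexp φ) x ≠ 0 ∧
      ‖Complex.log (conformalQuot ℝ (ρ (Lexp φ) x) x)‖ ≤ (totalVariation φ).toReal := by
  set r := (totalVariation φ).toReal with hr
  have key : ∀ ε : ℝ, 0 < ε → ε ≤ 1 / 2 → ρ (Lexp φ) x ≠ 0 ∧
      ‖Complex.log (conformalQuot ℝ (ρ (Lexp φ) x) x)‖ ≤ (1 + ε) * ((1 + ε) * r) := by
    intro ε h0 hε
    obtain ⟨l, hl1, hl2, hl3⟩ := exists_list_prod_eq_Lexp h1 φ hφ hatom h0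
    obtain ⟨hne, hle⟩ := norm_log_conformalQuot_list_prod_le ρ hρ hε l hl1 hx
    rw [hl3] at hne hle
    refine ⟨hne, hle.trans ?_⟩
    gcongr
  refine ⟨(key (1 / 2) (by norm_num) le_rfl).1, ?_⟩
  have ht : Filter.Tendsto (fun ε : ℝ => (1 + ε) * ((1 + ε) * r)) (nhdsWithin 0 (Ioi 0))
      (nhds ((1 + 0) * ((1 + 0) * r))) := by
    refine tendsto_nhdsWithin_of_tendsto_nhds (Continuous.tendsto ?_ 0)
    fun_prop
  have := ge_of_tendsto ht (b := ‖Complex.log (conformalQuot ℝ (ρ (Lexp φ) x) x)‖) (by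
    filter_upwards [Ioc_mem_nhdsGT (show (0 : ℝ) < 1 / 2 by norm_num)] with ε hε
    exact (key ε hε.1 hε.2).2)
  simpa using this

theorem isUnit_Lexp [NormedAlgebra ℝ 𝔄] [CompleteSpace 𝔄] {I : Set ℝ}
    (h1 : ‖(1 : 𝔄)‖ ≤ 1) (φ : VectorMeasure I 𝔄) (hφ : totalVariation φ < ⊤)
    (hatom : ∀ t : I, φ {t} = 0) : IsUnit (Lexp φ) := by
  obtain ⟨l, hl1, -, hl3⟩ := exists_list_prod_eq_Lexp h1 φ hφ hatom (ε := 1 / 2) (by norm_num)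
  rw [← hl3]
  refine List.prod_isUnit fun a ha => ?_
  obtain ⟨e, he, rfl⟩ := List.mem_map.1 ha
  have := isUnit_one_sub_of_norm_lt_one (x := -e) (by rw [norm_neg]; linarith [hl1 e he])
  rwa [sub_neg_eq_add] at this

end ConformalGeometry

/-! ### From the conformal range to the spectrum on a complex space. -/

theorem ContinuousLinearMap.isUnit_of_path {𝕜 K : Type*} [NontriviallyNormedField 𝕜]
    [NormedAddCommGroup K] [NormedSpace 𝕜 K] [CompleteSpace K] {f : ℝ → (K →L[𝕜] K)}
    (hf : Continuous f) {c : ℝ} (hc : 0 < c)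
    (hb : ∀ s ∈ Icc (0 : ℝ) 1, ∀ x, c * ‖x‖ ≤ ‖f s x‖) (h0 : IsUnit (f 0)) : IsUnit (f 1) := by
  have hopen : IsOpen {s | IsUnit (f s)} := Units.isOpen.preimage hf
  -- Invertibility is open; it is also closed along the path, since the uniform lower bound `c`
  -- keeps nearby inverses below `2 / c` in norm and a Neumann series reaches the limit point.
  refine isPreconnected_Icc.subset_of_closure_inter_subset hopen
    ⟨0, left_mem_Icc.2 zero_le_one, h0⟩ ?_ (right_mem_Icc.2 zero_le_one)
  rintro s ⟨hs, hsI⟩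
  have hnear : {t | ‖f t - f s‖ < c / 2} ∈ nhds s := by
    have : Filter.Tendsto (fun t => ‖f t - f s‖) (nhds s) (nhds 0) := by
      simpa using (hf.sub (continuous_const (y := f s))).norm.tendsto s
    exact this.eventually_lt_const (by positivity)
  obtain ⟨t, ht, ⟨u, hu⟩⟩ := mem_closure_iff_nhds.1 hs _ hnear
  have ht' : ‖f t - f s‖ < c / 2 := ht
  set v : K →L[𝕜] K := ↑u⁻¹ with hv
  have huv : ∀ x, f t (v x) = x := fun x => by
    rw [← hu, ← mul_apply_eq_comp, hv, Units.mul_inv]; rfl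
  have hvn : ‖v‖ ≤ 2 / c := by
    refine ContinuousLinearMap.opNorm_le_bound _ (by positivity) fun x => ?_
    have h1 := hb s hsI (v x)
    have h2 : ‖f s (v x)‖ ≤ ‖f t (v x)‖ + ‖f t - f s‖ * ‖v x‖ := by
      have := (f t - f s).le_opNorm (v x)
      have h3 : f s (v x) = f t (v x) - (f t - f s) (v x) := by simp
      rw [h3]
      exact (norm_sub_le _ _).trans (by gcongr)
    rw [huv] at h2
    have h4 : ‖f t - f s‖ * ‖v x‖ ≤ c / 2 * ‖v x‖ := by gcongr
    have h5 : c / 2 * ‖v x‖ ≤ ‖x‖ := by linarith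
    rw [div_mul_eq_mul_div, le_div_iff₀ hc]
    linarith
  have hfs : f s = u * (1 - v * (f t - f s)) := by
    rw [mul_sub, ← mul_assoc, hv, Units.mul_inv, hu]; simp
  show IsUnit (f s)
  rw [hfs]
  refine u.isUnit.mul (isUnit_one_sub_of_norm_lt_one ((norm_mul_le _ _).trans_lt ?_))
  calc ‖v‖ * ‖f t - f s‖ ≤ 2 / c * ‖f t - f s‖ := by gcongr
    _ < 2 / c * (c / 2) := by gcongr
    _ = 1 := by field_simp

theorem Complex.conj_mem_exp_image_closedBall {r : ℝ} {z : ℂ}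
    (hz : z ∈ Complex.exp '' Metric.closedBall 0 r) :
    starRingEnd ℂ z ∈ Complex.exp '' Metric.closedBall 0 r := by
  obtain ⟨w, hw, rfl⟩ := hz
  refine ⟨starRingEnd ℂ w, ?_, Complex.exp_conj w⟩
  simpa using hw

section ComplexSpectrum

attribute [local instance] InnerProductSpace.complexToReal

variable {K : Type*} [NormedAddCommGroup K] [InnerProductSpace ℂ K]

theorem conformalQuot_smul_left {V : Type*} [NormedAddCommGroup V] [InnerProductSpace ℝ V]
    {s : ℝ} (hs : 0 ≤ s) (y x : V) :
    conformalQuot ℝ (s • y) x = s * conformalQuot ℝ y x := by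
  have h : conformalOrth x (s • y) = s • conformalOrth x y := by
    simp only [conformalOrth, inner_smul_left, conj_trivial, smul_sub, smul_smul]
    congr 2 <;> ring
  apply Complex.ext
  · rw [conformalQuot_re, Complex.re_ofReal_mul, conformalQuot_re, inner_smul_left, conj_trivial,
      mul_div_assoc]
  · rw [conformalQuot_im, Complex.im_ofReal_mul, conformalQuot_im, h, norm_smul, Real.norm_eq_abs,
      abs_of_nonneg hs]

theorem conformalQuot_complex_eq_real (y x : K) :
    conformalQuot ℂ y x = conformalQuot ℝ y x := by
  apply Complex.ext
  · rfl
  · rfl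

/-- Conformal quotients see scalars only up to conjugation; the modulus `‖z‖` and the real part
determine `|z.im|`. -/
theorem conformalQuot_complex_smul_self {x : K} (hx : x ≠ 0) (z : ℂ) :
    conformalQuot ℝ (z • x) x = ⟨z.re, |z.im|⟩ := by
  have hn : ‖x‖ ≠ 0 := norm_ne_zero_iff.2 hx
  have hre : (conformalQuot ℝ (z • x) x).re = z.re := by
    rw [← conformalQuot_complex_eq_real]
    simp only [conformalQuot, inner_smul_left, inner_self_eq_norm_sq_to_K]
    rw [← RCLike.ofReal_pow, mul_comm, RCLike.re_ofReal_mul]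
    simp [hn]
  have him : (conformalQuot ℝ (z • x) x).im ^ 2 = |z.im| ^ 2 := by
    have h := norm_conformalQuot hx (z • x)
    rw [norm_smul, mul_div_cancel_right₀ _ hn] at h
    have h2 := congrArg (· ^ 2) h
    simp only [Complex.sq_norm, Complex.normSq_apply, hre] at h2
    rw [sq_abs]
    linarith
  apply Complex.ext
  · exact hre
  · exact (sq_eq_sq₀ (norm_nonneg _) (abs_nonneg _)).1 him

/-- Scaling by `s` translates the logarithm horizontally, and a translation that does not increase
`|Re w|` keeps it in the disc. -/
theorem Complex.mem_exp_image_closedBall_of_smul_eq {r s : ℝ} {w z : ℂ} (hw : ‖w‖ ≤ r)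
    (hs : 0 < s) (hlog : |w.re + Real.log s| ≤ |w.re|) (hz : (s : ℂ) * Complex.exp w = z) :
    z ∈ Complex.exp '' Metric.closedBall 0 r := by
  refine ⟨w + Real.log s, ?_, ?_⟩
  · rw [mem_closedBall_zero_iff]
    refine le_trans ?_ hw
    rw [← sq_le_sq₀ (norm_nonneg _) (norm_nonneg _), Complex.sq_norm, Complex.sq_norm,
      Complex.normSq_apply, Complex.normSq_apply]
    simp only [Complex.add_re, Complex.ofReal_re, Complex.add_im, Complex.ofReal_im, add_zero]
    have := sq_le_sq.2 hlog
    nlinarith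
  · rw [Complex.exp_add, ← Complex.ofReal_exp, Real.exp_log hs, mul_comm, hz]

theorem exists_pos_le_norm_of_isCompact {S : Set ℂ} (hS : IsCompact S) (h0 : (0 : ℂ) ∉ S) :
    ∃ c : ℝ, 0 < c ∧ ∀ z ∈ S, c ≤ ‖z‖ := by
  obtain ⟨c, hc, hcS⟩ := Metric.isOpen_iff.1 hS.isClosed.isOpen_compl 0 h0
  refine ⟨c, hc, fun z hz => ?_⟩
  by_contra! hlt
  exact hcS (mem_ball_zero_iff.2 hlt) hz

variable [CompleteSpace K]

/-- The set `S` is compact and conjugation-invariant, so a point `z ∉ S` may be folded to `z'` in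
the closed upper half plane. Contraction of conformal quotients turns a positive distance in the
plane into a lower bound for operators. -/
theorem spectrum_subset_exp_image_closedBall {A : K →L[ℂ] K} (hA : IsUnit A) {r : ℝ}
    (h : ∀ x, x ≠ 0 → A x ≠ 0 ∧ ‖Complex.log (conformalQuot ℝ (A x) x)‖ ≤ r) :
    spectrum ℂ A ⊆ Complex.exp '' Metric.closedBall 0 r := by
  intro z hz
  by_contra hzS
  set S := Complex.exp '' Metric.closedBall 0 r with hS
  have hSc : IsCompact S := (isCompact_closedBall 0 r).image Complex.continuous_exp
  set z' : ℂ := ⟨z.re, |z.im|⟩ with hz'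
  have hnz : ‖z'‖ = ‖z‖ := by
    rw [← sq_eq_sq₀ (norm_nonneg _) (norm_nonneg _), Complex.sq_norm, Complex.sq_norm,
      Complex.normSq_apply, Complex.normSq_apply]
    simp [hz']
  have hz'S : z' ∉ S := by
    intro hmem
    rcases le_total 0 z.im with him | him
    · exact hzS (by
        convert hmem using 1
        apply Complex.ext <;> simp [hz', abs_of_nonneg him])
    · exact hzS (by
        convert Complex.conj_mem_exp_image_closedBall hmem using 1
        apply Complex.ext <;> simp [hz', abs_of_nonpos him])
  have hq : ∀ x, x ≠ 0 → conformalQuot ℝ (A x) x ∈ S := fun x hx => by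
    refine ⟨Complex.log (conformalQuot ℝ (A x) x), mem_closedBall_zero_iff.2 (h x hx).2,
      Complex.exp_log ?_⟩
    rw [← norm_pos_iff, norm_conformalQuot hx]
    exact div_pos (norm_pos_iff.2 (h x hx).1) (norm_pos_iff.2 hx)
  have hnorm : ∀ w : ℂ, ‖Complex.exp w‖ = Real.exp w.re := Complex.norm_exp
  refine hz (show IsUnit (algebraMap ℂ (K →L[ℂ] K) z - A) from ?_)
  -- For `1 ≤ ‖z‖` the path is `z - s A`, starting at a nonzero scalar. If `z' = s * exp w`, then `0
  -- ≤ log ‖z‖ = w.re + log s ≤ w.re`, which would put `z'` in `S`.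
  rcases le_total 1 ‖z‖ with h1 | h1
  · have h0 : (0 : ℂ) ∉ (fun p : ℝ × ℂ => z' - p.1 * p.2) '' (Icc (0 : ℝ) 1 ×ˢ S) := by
      rintro ⟨⟨s, _⟩, ⟨hs, ⟨w, hw, rfl⟩⟩, heq⟩
      simp only at hs heq
      have heq' : (s : ℂ) * Complex.exp w = z' := (sub_eq_zero.1 heq).symm
      have hne := congrArg norm heq'
      rw [norm_mul, Complex.norm_real, Real.norm_eq_abs, abs_of_nonneg hs.1, hnz, hnorm] at hne
      have hs0 : 0 < s := by
        rcases hs.1.eq_or_lt with h' | h'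
        · rw [← h', zero_mul] at hne; linarith
        · exact h'
      refine hz'S (Complex.mem_exp_image_closedBall_of_smul_eq (mem_closedBall_zero_iff.1 hw) hs0 ?_
        heq')
      have hl : Real.log s ≤ 0 := Real.log_nonpos hs.1 hs.2
      have hl2 : 0 ≤ w.re + Real.log s := by
        have := Real.log_nonneg h1
        rwa [← hne, Real.log_mul hs0.ne' (Real.exp_pos _).ne', Real.log_exp, add_comm] at this
      rw [abs_of_nonneg hl2, abs_of_nonneg (by linarith)]
      linarith
    obtain ⟨c, hc, hcS⟩ := exists_pos_le_norm_of_isCompact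
      ((isCompact_Icc.prod hSc).image (by fun_prop)) h0
    have := ContinuousLinearMap.isUnit_of_path
      (f := fun s : ℝ => algebraMap ℂ (K →L[ℂ] K) z - s • A) (by fun_prop) hc ?_ ?_
    · simpa using this
    · intro s hs x
      rcases eq_or_ne x 0 with rfl | hx
      · simp
      have h2 := norm_conformalQuot_sub_le hx (z • x) (s • A x)
      rw [conformalQuot_complex_smul_self hx, conformalQuot_smul_left hs.1] at h2
      have h3 := (hcS _ ⟨(s, _), ⟨hs, hq x hx⟩, rfl⟩).trans h2
      rw [le_div_iff₀ (norm_pos_iff.2 hx)] at h3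
      simpa [Algebra.algebraMap_eq_smul_one] using h3
    · have hz0 : z ≠ 0 := norm_pos_iff.1 (by linarith)
      simpa using (IsUnit.mk0 z hz0).map (algebraMap ℂ (K →L[ℂ] K))
  -- For `‖z‖ ≤ 1` the path is `s z - A`, starting at the invertible `-A`; now the logarithm moves
  -- towards the imaginary axis from the left.
  · have h0 : (0 : ℂ) ∉ (fun p : ℝ × ℂ => p.1 * z' - p.2) '' (Icc (0 : ℝ) 1 ×ˢ S) := by
      rintro ⟨⟨s, _⟩, ⟨hs, ⟨w, hw, rfl⟩⟩, heq⟩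
      simp only at hs heq
      have heq' : (s : ℂ) * z' = Complex.exp w := sub_eq_zero.1 heq
      have hne := congrArg norm heq'
      rw [norm_mul, Complex.norm_real, Real.norm_eq_abs, abs_of_nonneg hs.1, hnz, hnorm] at hne
      have hs0 : 0 < s := by
        rcases hs.1.eq_or_lt with h' | h'
        · rw [← h', zero_mul] at hne; exact absurd hne (Real.exp_pos _).ne
        · exact h'
      have hzpos : 0 < ‖z‖ := by
        rcases (norm_nonneg z).eq_or_lt with h' | h'
        · rw [← h', mul_zero] at hne; exact absurd hne (Real.exp_pos _).ne
        · exact h'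
      refine hz'S (Complex.mem_exp_image_closedBall_of_smul_eq (s := s⁻¹)
        (mem_closedBall_zero_iff.1 hw) (inv_pos.2 hs0) ?_ ?_)
      · have hl : Real.log s ≤ 0 := Real.log_nonpos hs.1 hs.2
        have hl2 : Real.log s + Real.log ‖z‖ = w.re := by
          rw [← Real.log_mul hs0.ne' hzpos.ne', hne, Real.log_exp]
        have hl3 := Real.log_nonpos hzpos.le h1
        rw [Real.log_inv, abs_of_nonpos (by linarith), abs_of_nonpos (by linarith)]
        linarith
      · rw [← heq', ← mul_assoc, ← Complex.ofReal_mul, inv_mul_cancel₀ hs0.ne', Complex.ofReal_one,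
          one_mul]
    obtain ⟨c, hc, hcS⟩ := exists_pos_le_norm_of_isCompact
      ((isCompact_Icc.prod hSc).image (by fun_prop)) h0
    have := ContinuousLinearMap.isUnit_of_path
      (f := fun s : ℝ => s • algebraMap ℂ (K →L[ℂ] K) z - A) (by fun_prop) hc ?_ ?_
    · simpa using this
    · intro s hs x
      rcases eq_or_ne x 0 with rfl | hx
      · simp
      have h2 := norm_conformalQuot_sub_le hx (s • z • x) (A x)
      rw [conformalQuot_smul_left hs.1, conformalQuot_complex_smul_self hx] at h2
      have h3 := (hcS _ ⟨(s, _), ⟨hs, hq x hx⟩, rfl⟩).trans h2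
      rw [le_div_iff₀ (norm_pos_iff.2 hx)] at h3
      simpa [Algebra.algebraMap_eq_smul_one] using h3
    · simpa using hA.neg

end ComplexSpectrum

/-! ### The integral logarithm: functoriality and the scalar case. -/

section AlgebraicLogarithm

theorem RingHom.map_ringInverse_of_isUnit {R S : Type*} [Ring R] [Ring S] (f : R →+* S) {a : R}
    (ha : IsUnit a) : f (Ring.inverse a) = Ring.inverse (f a) := by
  obtain ⟨u, rfl⟩ := ha
  have h : f ↑u = (Units.map f.toMonoidHom u : S) := rfl
  rw [Ring.inverse_unit, h, Ring.inverse_unit, ← map_inv]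
  rfl

variable {𝔄 𝔅 : Type*} [NormedRing 𝔄] [NormedAlgebra ℝ 𝔄]
  [NormedRing 𝔅] [NormedAlgebra ℝ 𝔅]

theorem LogWellDefined.isUnit {a : 𝔄} (ha : LogWellDefined a) {s : ℝ} (hs : s ∈ Icc (0 : ℝ) 1) :
    IsUnit (s • (1 : 𝔄) + (1 - s) • a) := by
  have h := ha (1 - s) ⟨by linarith [hs.2], by linarith [hs.1]⟩
  rwa [sub_sub_cancel] at h

variable [CompleteSpace 𝔄]

theorem LogWellDefined.continuousOn_integrand {a : 𝔄} (ha : LogWellDefined a) :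
    ContinuousOn (fun s : ℝ => (a - 1) * Ring.inverse (s • (1 : 𝔄) + (1 - s) • a))
      (uIcc 0 1) := by
  rw [uIcc_of_le zero_le_one]
  refine continuousOn_const.mul fun s hs => ContinuousAt.continuousWithinAt ?_
  obtain ⟨u, hu⟩ := ha.isUnit hs
  refine ContinuousAt.comp (g := Ring.inverse) (f := fun s : ℝ => s • (1 : 𝔄) + (1 - s) • a) ?_
    (Continuous.continuousAt (by fun_prop))
  rw [← hu]
  exact NormedRing.inverse_continuousAt u

theorem map_algLog [CompleteSpace 𝔅] (F : 𝔄 →ₐ[ℝ] 𝔅) (hF : Continuous F) {a : 𝔄} (ha : LogWellDefined a) :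
    F (algLog a) = algLog (F a) := by
  have h := ContinuousLinearMap.intervalIntegral_comp_comm (𝕜 := ℝ) (⟨F.toLinearMap, hF⟩ : 𝔄 →L[ℝ] 𝔅)
    (ha.continuousOn_integrand.intervalIntegrable (μ := volume))
  refine h.symm.trans (intervalIntegral.integral_congr fun s hs => ?_)
  rw [uIcc_of_le zero_le_one] at hs
  show F ((a - 1) * Ring.inverse (s • (1 : 𝔄) + (1 - s) • a)) = _
  have h2 := F.toRingHom.map_ringInverse_of_isUnit (ha.isUnit hs)
  simp only [AlgHom.toRingHom_eq_coe, RingHom.coe_coe] at h2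
  simp [h2]

theorem segment_mem_slitPlane {z : ℂ} (hz : z ∈ Complex.slitPlane) {s : ℝ}
    (hs : s ∈ Icc (0 : ℝ) 1) : (s : ℂ) + (1 - s) * z ∈ Complex.slitPlane := by
  have h := Complex.starConvex_one_slitPlane hz hs.1 (by linarith [hs.2] : 0 ≤ 1 - s) (by ring)
  simpa using h

theorem Complex.logWellDefined {z : ℂ} (hz : z ∈ Complex.slitPlane) : LogWellDefined z := by
  intro t ht
  have h := segment_mem_slitPlane hz (s := 1 - t) ⟨by linarith [ht.2], by linarith [ht.1]⟩
  have h2 := Complex.slitPlane_ne_zero h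
  rw [isUnit_iff_ne_zero]
  simpa using h2

/-- The integrand has primitive `-log (s + (1 - s) z)`, as the segment from `z` to `1` stays in the
slit plane. -/
theorem Complex.algLog_eq_log {z : ℂ} (hz : z ∈ Complex.slitPlane) : algLog z = Complex.log z := by
  have hint := (Complex.logWellDefined hz).continuousOn_integrand.intervalIntegrable (μ := volume)
  have h := intervalIntegral.integral_eq_sub_of_hasDerivAt
    (f := fun s : ℝ => -Complex.log ((s : ℂ) + (1 - s) * z)) (fun s hs => ?_) hint
  · rw [algLog, h]
    simp
  · rw [uIcc_of_le zero_le_one] at hs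
    have hmem := segment_mem_slitPlane hz hs
    have h1 : HasDerivAt (fun s : ℝ => (s : ℂ) + (1 - s) * z) (1 - z) s := by
      have h2 := (Complex.ofRealCLM.hasDerivAt (x := s))
      have h3 := h2.add ((h2.const_sub 1).mul_const z)
      refine HasDerivAt.congr_deriv (f := fun s : ℝ => (s : ℂ) + (1 - s) * z) h3 ?_
      rw [Complex.ofRealCLM_apply, Complex.ofReal_one]
      ring
    refine ((h1.clog_real hmem).neg).congr_deriv ?_
    rw [Ring.inverse_eq_inv']
    simp only [Complex.real_smul, Complex.ofReal_sub, Complex.ofReal_one, mul_one]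
    rw [← neg_div, neg_sub, div_eq_mul_inv]

end AlgebraicLogarithm

/-! ### Spectral mapping for the logarithm. -/

section SpectralMapping

theorem logWellDefined_of_spectrum_subset {𝔅 : Type*} [NormedRing 𝔅] [NormedAlgebra ℂ 𝔅] {b : 𝔅}
    (hb : spectrum ℂ b ⊆ Complex.slitPlane) : LogWellDefined b := by
  intro t ht
  rcases ht.1.eq_or_lt with h0 | h0
  · simp [← h0]
  -- For `t > 0`, `(1 - t) + t b` is `-t` times `-(1 - t)/t - b`, and a nonpositive real is outside
  -- the slit plane.
  have hz : ((-((1 - t) / t) : ℝ) : ℂ) ∉ spectrum ℂ b := fun hmem => by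
    have h1 := hb hmem
    rw [Complex.ofReal_mem_slitPlane] at h1
    have : 0 ≤ (1 - t) / t := div_nonneg (by linarith [ht.2]) h0.le
    linarith
  rw [spectrum.notMem_iff] at hz
  have hu : IsUnit (algebraMap ℂ 𝔅 (-t : ℝ)) :=
    (IsUnit.mk0 _ (by exact_mod_cast (neg_ne_zero.2 h0.ne'))).map _
  have h2 := hu.mul hz
  convert h2 using 1
  rw [mul_sub, ← map_mul, ← Complex.ofReal_mul, ← Algebra.smul_def, Algebra.algebraMap_eq_smul_one,
    show -t * -((1 - t) / t) = 1 - t by field_simp]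
  rw [← Complex.coe_smul (1 - t) (1 : 𝔅), Complex.ofReal_neg, neg_smul, sub_neg_eq_add,
    Complex.coe_smul t b]

theorem spectrum_algLog_subset_of_comm {A : Type*} [NormedCommRing A] [NormedAlgebra ℂ A]
    [CompleteSpace A] {a : A} (ha : spectrum ℂ a ⊆ Complex.slitPlane) :
    spectrum ℂ (algLog a) ⊆ Complex.log '' spectrum ℂ a := by
  intro z hz
  obtain ⟨χ, rfl⟩ := WeakDual.CharacterSpace.mem_spectrum_iff_exists.1 hz
  have hmem : χ a ∈ spectrum ℂ a := WeakDual.CharacterSpace.mem_spectrum_iff_exists.2 ⟨χ, rfl⟩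
  refine ⟨χ a, hmem, ?_⟩
  have h := map_algLog ((WeakDual.CharacterSpace.toAlgHom χ).restrictScalars ℝ) (map_continuous χ)
    (logWellDefined_of_spectrum_subset ha)
  rw [← Complex.algLog_eq_log (ha hmem)]
  exact h.symm

/-- The bicommutant `C` of `b` is closed, commutative and stable under inverses. So `b` has no
larger spectrum in `C` than in `𝔅`, and characters of `C` reduce the claim to scalars. -/
theorem spectrum_algLog_subset {𝔅 : Type*} [NormedRing 𝔅] [NormedAlgebra ℂ 𝔅]
    [CompleteSpace 𝔅] {b : 𝔅} (hb : spectrum ℂ b ⊆ Complex.slitPlane) :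
    spectrum ℂ (algLog b) ⊆ Complex.log '' spectrum ℂ b := by
  let D : Subalgebra ℂ 𝔅 := Subalgebra.centralizer ℂ {b}
  let C : Subalgebra ℂ 𝔅 := Subalgebra.centralizer ℂ (D : Set 𝔅)
  have hbD : b ∈ D := by
    rw [Subalgebra.mem_centralizer_iff]
    rintro g rfl
    rfl
  have hCD : ∀ c ∈ C, c ∈ D := fun c hc => by
    rw [Subalgebra.mem_centralizer_iff] at hc ⊢
    rintro g rfl
    exact hc g hbD
  have hbC : b ∈ C := by
    rw [Subalgebra.mem_centralizer_iff]
    intro g hg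
    exact ((Subalgebra.mem_centralizer_iff ℂ).1 hg b rfl).symm
  have hclosed : IsClosed (C : Set 𝔅) := Set.isClosed_centralizer _
  let _ : NormedCommRing C :=
    { (inferInstance : NormedRing C) with
      mul_comm := fun x y => Subtype.ext
        ((Subalgebra.mem_centralizer_iff ℂ).1 y.2 x (hCD x x.2)) }
  have : CompleteSpace C := hclosed.completeSpace_coe
  have hspec : spectrum ℂ (⟨b, hbC⟩ : C) ⊆ spectrum ℂ b := by
    intro z hz hz'
    refine hz ?_
    obtain ⟨u, hu⟩ : IsUnit (algebraMap ℂ 𝔅 z - b) := hz'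
    have huC : (u : 𝔅) ∈ C := by
      rw [hu]; exact sub_mem (Subalgebra.algebraMap_mem C z) hbC
    have hinv : (↑u⁻¹ : 𝔅) ∈ C := by
      rw [Subalgebra.mem_centralizer_iff] at huC ⊢
      intro g hg
      have : Commute g (u : 𝔅) := huC g hg
      exact this.units_inv_right
    show IsUnit (algebraMap ℂ C z - ⟨b, hbC⟩)
    refine IsUnit.of_mul_eq_one ⟨_, hinv⟩ (Subtype.ext ?_)
    show (algebraMap ℂ 𝔅 z - b) * ↑u⁻¹ = 1
    rw [← hu, Units.mul_inv]
  have hb' := hspec.trans hb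
  have h := map_algLog (C.val.restrictScalars ℝ) continuous_subtype_val
    (logWellDefined_of_spectrum_subset hb')
  intro z hz
  have h1 : algLog b = C.val (algLog (⟨b, hbC⟩ : C)) := h.symm
  rw [h1] at hz
  obtain ⟨w, hw, rfl⟩ := spectrum_algLog_subset_of_comm hb' (AlgHom.spectrum_apply_subset C.val _ hz)
  exact ⟨w, hspec hw, rfl⟩

theorem Complex.exp_mem_slitPlane_of_norm_lt_pi {w : ℂ} (hw : ‖w‖ < Real.pi) :
    Complex.exp w ∈ Complex.slitPlane ∧ Complex.log (Complex.exp w) = w := by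
  have h1 := abs_lt.1 ((Complex.abs_im_le_norm w).trans_lt hw)
  have h2 := Complex.log_exp h1.1 h1.2.le
  refine ⟨?_, h2⟩
  rw [Complex.mem_slitPlane_iff_arg]
  refine ⟨?_, Complex.exp_ne_zero w⟩
  rw [← Complex.log_im, h2]
  exact h1.2.ne

theorem logWellDefined_and_spectrum_algLog_subset {𝔅 : Type*} [NormedRing 𝔅] [NormedAlgebra ℂ 𝔅]
    [CompleteSpace 𝔅] {b : 𝔅} {r : ℝ} (hr : r < Real.pi)
    (hb : spectrum ℂ b ⊆ Complex.exp '' Metric.closedBall 0 r) :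
    LogWellDefined b ∧ spectrum ℂ (algLog b) ⊆ Metric.closedBall 0 r := by
  have hb' : spectrum ℂ b ⊆ Complex.slitPlane := fun z hz => by
    obtain ⟨w, hw, rfl⟩ := hb hz
    exact (Complex.exp_mem_slitPlane_of_norm_lt_pi ((mem_closedBall_zero_iff.1 hw).trans_lt hr)).1
  refine ⟨logWellDefined_of_spectrum_subset hb', fun z hz => ?_⟩
  obtain ⟨y, hy, rfl⟩ := spectrum_algLog_subset hb' hz
  obtain ⟨w, hw, rfl⟩ := hb hy
  rwa [(Complex.exp_mem_slitPlane_of_norm_lt_pi ((mem_closedBall_zero_iff.1 hw).trans_lt hr)).2]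

theorem spectralRadius_le_of_spectrum_subset_closedBall {A : Type*} [Ring A] [Algebra ℂ A] {a : A}
    {R : ENNReal} (ha : spectrum ℂ a ⊆ Metric.closedBall 0 R.toReal) :
    spectralRadius ℂ a ≤ R := by
  refine iSup₂_le fun z hz => ?_
  have h := mem_closedBall_zero_iff.1 (ha hz)
  rw [← enorm_eq_nnnorm, ← ofReal_norm]
  exact ENNReal.ofReal_le_of_le_toReal h

end SpectralMapping

/-! ### Complexifying real Hilbert spaces and their operators. -/

section Complexification

/-- The complexification `H ⊕ iH` of a real Hilbert space. -/
def Complexification (H : Type*) : Type _ := WithLp 2 (H × H)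

namespace Complexification

variable {H : Type*} [NormedAddCommGroup H]

noncomputable instance : NormedAddCommGroup (Complexification H) :=
  inferInstanceAs (NormedAddCommGroup (WithLp 2 (H × H)))

instance [CompleteSpace H] : CompleteSpace (Complexification H) :=
  inferInstanceAs (CompleteSpace (WithLp 2 (H × H)))

/-- The vector `x + iy`. -/
def mk (x y : H) : Complexification H := WithLp.toLp 2 (x, y)

/-- The real part. -/
def re (v : Complexification H) : H := WithLp.fst v

/-- The imaginary part. -/
def im (v : Complexification H) : H := WithLp.snd v

@[simp] theorem re_mk (x y : H) : (mk x y).re = x := rfl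
@[simp] theorem im_mk (x y : H) : (mk x y).im = y := rfl
@[simp] theorem re_add (v w : Complexification H) : (v + w).re = v.re + w.re := rfl
@[simp] theorem im_add (v w : Complexification H) : (v + w).im = v.im + w.im := rfl

theorem ext {v w : Complexification H} (h1 : v.re = w.re) (h2 : v.im = w.im) : v = w :=
  (WithLp.equiv 2 (H × H)).injective (Prod.ext h1 h2)

theorem norm_sq (v : Complexification H) : ‖v‖ ^ 2 = ‖v.re‖ ^ 2 + ‖v.im‖ ^ 2 :=
  WithLp.prod_norm_sq_eq_of_L2 v

variable [InnerProductSpace ℝ H]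

/-- Multiplication by complex scalars. -/
noncomputable abbrev complexModule : Module ℂ (Complexification H) where
  smul z v := mk (z.re • v.re - z.im • v.im) (z.re • v.im + z.im • v.re)
  one_smul v := ext (show (1 : ℂ).re • v.re - (1 : ℂ).im • v.im = v.re by simp)
    (show (1 : ℂ).re • v.im + (1 : ℂ).im • v.re = v.im by simp)
  mul_smul z w v := ext
    (show (z * w).re • v.re - (z * w).im • v.im = z.re • (w.re • v.re - w.im • v.im) -
      z.im • (w.re • v.im + w.im • v.re) by simp only [Complex.mul_re, Complex.mul_im]; module)
    (show (z * w).re • v.im + (z * w).im • v.re = z.re • (w.re • v.im + w.im • v.re) +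
      z.im • (w.re • v.re - w.im • v.im) by simp only [Complex.mul_re, Complex.mul_im]; module)
  smul_zero z := ext (show z.re • (0 : H) - z.im • (0 : H) = 0 by simp)
    (show z.re • (0 : H) + z.im • (0 : H) = 0 by simp)
  smul_add z v w := ext
    (show z.re • (v.re + w.re) - z.im • (v.im + w.im) =
      (z.re • v.re - z.im • v.im) + (z.re • w.re - z.im • w.im) by module)
    (show z.re • (v.im + w.im) + z.im • (v.re + w.re) =
      (z.re • v.im + z.im • v.re) + (z.re • w.im + z.im • w.re) by module)
  add_smul z w v := ext
    (show (z + w).re • v.re - (z + w).im • v.im = (z.re • v.re - z.im • v.im) +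
      (w.re • v.re - w.im • v.im) by simp only [Complex.add_re, Complex.add_im]; module)
    (show (z + w).re • v.im + (z + w).im • v.re = (z.re • v.im + z.im • v.re) +
      (w.re • v.im + w.im • v.re) by simp only [Complex.add_re, Complex.add_im]; module)
  zero_smul v := ext (show (0 : ℂ).re • v.re - (0 : ℂ).im • v.im = 0 by simp)
    (show (0 : ℂ).re • v.im + (0 : ℂ).im • v.re = 0 by simp)

/-- The complexification as a complex normed space. -/
noncomputable abbrev complexNormedSpace : NormedSpace ℂ (Complexification H) where
  toModule := complexModule
  norm_smul_le z v := by
    let _ : Module ℂ (Complexification H) := complexModule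
    rw [← sq_le_sq₀ (norm_nonneg _) (by positivity), mul_pow, norm_sq, norm_sq, Complex.sq_norm,
      Complex.normSq_apply]
    show ‖z.re • v.re - z.im • v.im‖ ^ 2 + ‖z.re • v.im + z.im • v.re‖ ^ 2 ≤ _
    rw [norm_sub_sq_real, norm_add_sq_real]
    simp only [inner_smul_left, inner_smul_right, norm_smul, mul_pow, Real.norm_eq_abs, sq_abs,
      conj_trivial, real_inner_comm v.re v.im]
    apply le_of_eq
    ring

noncomputable instance : InnerProductSpace ℂ (Complexification H) :=
  letI := complexNormedSpace (H := H)
  -- By Jordan–von Neumann, the parallelogram law of the underlying real norm suffices.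
  InnerProductSpace.ofNorm ℂ fun x y => by
    simp only [← sq]
    exact parallelogram_law_with_norm ℝ (E := WithLp 2 (H × H)) x y

@[simp] theorem re_smul (z : ℂ) (v : Complexification H) :
    (z • v).re = z.re • v.re - z.im • v.im := rfl

@[simp] theorem im_smul (z : ℂ) (v : Complexification H) :
    (z • v).im = z.re • v.im + z.im • v.re := rfl

/-- The complex-linear extension of a real operator. -/
noncomputable def extendFun (T : H →L[ℝ] H) : Complexification H →L[ℂ] Complexification H :=
  LinearMap.mkContinuous
    { toFun := fun v => mk (T v.re) (T v.im)
      map_add' := fun v w => ext (by simp) (by simp)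
      map_smul' := fun z v => ext (by simp) (by simp) } ‖T‖ fun v => by
    rw [← sq_le_sq₀ (norm_nonneg _) (by positivity), mul_pow, norm_sq, norm_sq, mul_add]
    simp only [LinearMap.coe_mk, AddHom.coe_mk, re_mk, im_mk, ← mul_pow]
    gcongr <;> exact T.le_opNorm _

@[simp] theorem re_extendFun (T : H →L[ℝ] H) (v : Complexification H) :
    (extendFun T v).re = T v.re := rfl

@[simp] theorem im_extendFun (T : H →L[ℝ] H) (v : Complexification H) :
    (extendFun T v).im = T v.im := rfl

/-- The embedding of the real operator algebra into the complex one. -/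
noncomputable def extend :
    (H →L[ℝ] H) →ₐ[ℝ] (Complexification H →L[ℂ] Complexification H) where
  toFun := extendFun
  map_one' := by ext1 v; exact ext rfl rfl
  map_mul' S T := by ext1 v; exact ext rfl rfl
  map_zero' := by ext1 v; exact ext rfl rfl
  map_add' S T := by ext1 v; exact ext rfl rfl
  commutes' r := by
    ext1 v
    refine ext ?_ ?_
    · simp [Algebra.algebraMap_eq_smul_one, ← Complex.coe_smul]
    · simp [Algebra.algebraMap_eq_smul_one, ← Complex.coe_smul]

theorem norm_extend_apply_le (T : H →L[ℝ] H) (v : Complexification H) :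
    ‖extend T v‖ ≤ ‖T‖ * ‖v‖ :=
  (extendFun T).le_of_opNorm_le (LinearMap.mkContinuous_norm_le _ (norm_nonneg T) _) v

theorem continuous_extend : Continuous (extend (H := H)) :=
  AddMonoidHomClass.continuous_of_bound extend 1 fun T => by
    rw [one_mul]
    exact ContinuousLinearMap.opNorm_le_bound _ (norm_nonneg T) (norm_extend_apply_le T)

variable [CompleteSpace H]

theorem isUnit_of_isUnit_extend {T : H →L[ℝ] H} (hT : IsUnit (extend T)) : IsUnit T := by
  rw [ContinuousLinearMap.isUnit_iff_bijective] at hT ⊢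
  constructor
  · intro x y hxy
    have h := hT.1 (a₁ := mk x 0) (a₂ := mk y 0) (ext hxy rfl)
    exact congrArg re h
  · intro y
    obtain ⟨v, hv⟩ := hT.2 (mk y 0)
    exact ⟨v.re, congrArg re hv⟩

theorem map_quadratic_eq {A B : Type*} [Ring A] [Algebra ℝ A] [Ring B] [Algebra ℝ B] [Algebra ℂ B]
    (hB : ∀ x : ℝ, algebraMap ℂ B x = algebraMap ℝ B x) (F : A →ₐ[ℝ] B) (a : A) (z : ℂ) :
    F (a * a - algebraMap ℝ A (2 * z.re) * a + algebraMap ℝ A (z.re * z.re + z.im * z.im)) =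
      (algebraMap ℂ B z - F a) * (algebraMap ℂ B (starRingEnd ℂ z) - F a) := by
  have h1 : algebraMap ℂ B z * algebraMap ℂ B (starRingEnd ℂ z) =
      algebraMap ℝ B (z.re * z.re + z.im * z.im) := by
    rw [← map_mul, Complex.mul_conj, Complex.normSq_apply, hB]
  have h2 : algebraMap ℂ B z * F a + F a * algebraMap ℂ B (starRingEnd ℂ z) =
      algebraMap ℝ B (2 * z.re) * F a := by
    rw [← Algebra.commutes, ← add_mul, ← map_add, Complex.add_conj, hB]
  simp only [map_add F, map_sub F, map_mul F, AlgHom.commutes]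
  rw [sub_mul, mul_sub, mul_sub, h1, ← h2]
  abel

/-- The product `(z - T)(z̄ - T)` is a real quadratic polynomial in `T`. Its invertibility descends
from `H ⊕ iH` to `H` and then passes to the tensor product, where the commuting factors are
invertible separately. No identification of the two complex algebras is needed. -/
theorem notMem_spectrum_complexify {T : H →L[ℝ] H} {z : ℂ}
    (h1 : IsUnit (algebraMap ℂ _ z - extend T))
    (h2 : IsUnit (algebraMap ℂ _ (starRingEnd ℂ z) - extend T)) :
    z ∉ spectrum ℂ (complexify T) := by
  rw [spectrum.notMem_iff]
  have h := h1.mul h2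
  rw [← map_quadratic_eq fun x => rfl] at h
  have hQ := (isUnit_of_isUnit_extend h).map
    (Algebra.TensorProduct.includeRight : (H →L[ℝ] H) →ₐ[ℝ] ℂ ⊗[ℝ] (H →L[ℝ] H))
  rw [map_quadratic_eq (fun x => rfl) (Algebra.TensorProduct.includeRight :
    (H →L[ℝ] H) →ₐ[ℝ] ℂ ⊗[ℝ] (H →L[ℝ] H)) T z] at hQ
  refine (Commute.isUnit_mul_iff ?_).1 hQ |>.1
  exact (Algebra.commute_algebraMap_left z _).sub_left
    ((Algebra.commute_algebraMap_right _ _).sub_right (Commute.refl _))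

theorem spectrum_complexify_subset (T : H →L[ℝ] H) {S : Set ℂ}
    (hS : ∀ z ∈ S, starRingEnd ℂ z ∈ S) (hT : spectrum ℂ (extend T) ⊆ S) :
    spectrum ℂ (complexify T) ⊆ S := by
  intro z hz
  by_contra hzS
  have hzS' : starRingEnd ℂ z ∉ S := fun h => hzS (by simpa using hS _ h)
  exact (notMem_spectrum_complexify (spectrum.notMem_iff.1 fun h => hzS (hT h))
    (spectrum.notMem_iff.1 fun h => hzS' (hT h))) hz

end Complexification

end Complexification

/-! ### Assembling the complex and real cases. -/

section OperatorLexp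

theorem conformalRange_subset_of_norm_log_le {𝕜 H : Type*} [RCLike 𝕜] [NormedAddCommGroup H]
    [InnerProductSpace 𝕜 H] [InnerProductSpace ℝ H] {A : H →L[𝕜] H} {r : ℝ}
    (heq : ∀ x y : H, conformalQuot 𝕜 y x = conformalQuot ℝ y x)
    (h : ∀ x, x ≠ 0 → A x ≠ 0 ∧ ‖Complex.log (conformalQuot ℝ (A x) x)‖ ≤ r) :
    conformalRange A ⊆ Complex.exp '' Metric.closedBall 0 r := by
  have hmem : ∀ x, x ≠ 0 → conformalQuot 𝕜 (A x) x ∈ Complex.exp '' Metric.closedBall 0 r := by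
    intro x hx
    rw [heq]
    refine ⟨Complex.log (conformalQuot ℝ (A x) x), mem_closedBall_zero_iff.2 (h x hx).2,
      Complex.exp_log ?_⟩
    rw [← norm_pos_iff, norm_conformalQuot hx]
    exact div_pos (norm_pos_iff.2 (h x hx).1) (norm_pos_iff.2 hx)
  rintro z ⟨x, hx, rfl | rfl⟩
  · exact hmem x hx
  · exact Complex.conj_mem_exp_image_closedBall (hmem x hx)

attribute [local instance] InnerProductSpace.complexToReal

theorem spectrum_map_Lexp_subset {I : Set ℝ} {𝔄 K : Type*} [NormedRing 𝔄] [NormedAlgebra ℝ 𝔄]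
    [CompleteSpace 𝔄] [NormedAddCommGroup K] [InnerProductSpace ℂ K] [CompleteSpace K]
    (h1 : ‖(1 : 𝔄)‖ ≤ 1) (φ : VectorMeasure I 𝔄) (hφ : totalVariation φ < ⊤)
    (hatom : ∀ t : I, φ {t} = 0) (ρ : 𝔄 →+* (K →L[ℂ] K)) (hρ : ∀ a v, ‖ρ a v‖ ≤ ‖a‖ * ‖v‖) :
    spectrum ℂ (ρ (Lexp φ)) ⊆ Complex.exp '' Metric.closedBall 0 (totalVariation φ).toReal :=
  spectrum_subset_exp_image_closedBall ((isUnit_Lexp h1 φ hφ hatom).map ρ) fun _ hx =>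
    norm_log_conformalQuot_Lexp_le h1 φ hφ hatom ρ hρ hx

theorem Lexp_complex {I : Set ℝ} {H : Type*} [NormedAddCommGroup H] [InnerProductSpace ℂ H]
    [CompleteSpace H] (φ : VectorMeasure I (H →L[ℂ] H)) (hφ : totalVariation φ < ⊤)
    (hatom : ∀ t : I, φ {t} = 0) :
    conformalRange (Lexp φ) ⊆ Complex.exp '' Metric.closedBall 0 (totalVariation φ).toReal ∧
      spectrum ℂ (Lexp φ) ⊆ Complex.exp '' Metric.closedBall 0 (totalVariation φ).toReal ∧
      ((totalVariation φ).toReal < Real.pi →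
        LogWellDefined (Lexp φ) ∧
        spectralRadius ℂ (algLog (Lexp φ)) ≤ totalVariation φ) := by
  have h1 : ‖(1 : H →L[ℂ] H)‖ ≤ 1 := ContinuousLinearMap.norm_id_le
  have hspec := spectrum_map_Lexp_subset h1 φ hφ hatom (RingHom.id _) fun a v => a.le_opNorm v
  refine ⟨conformalRange_subset_of_norm_log_le (fun x y => conformalQuot_complex_eq_real y x)
    fun x hx => norm_log_conformalQuot_Lexp_le h1 φ hφ hatom (RingHom.id _)
      (fun a v => a.le_opNorm v) hx, hspec, fun hr => ?_⟩
  obtain ⟨hlog, hspec'⟩ := logWellDefined_and_spectrum_algLog_subset hr hspec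
  exact ⟨hlog, spectralRadius_le_of_spectrum_subset_closedBall hspec'⟩

theorem Lexp_real {I : Set ℝ} {H : Type*} [NormedAddCommGroup H] [InnerProductSpace ℝ H]
    [CompleteSpace H] (φ : VectorMeasure I (H →L[ℝ] H)) (hφ : totalVariation φ < ⊤)
    (hatom : ∀ t : I, φ {t} = 0) :
    conformalRange (Lexp φ) ⊆ Complex.exp '' Metric.closedBall 0 (totalVariation φ).toReal ∧
      spectrum ℂ (complexify (Lexp φ)) ⊆
        Complex.exp '' Metric.closedBall 0 (totalVariation φ).toReal ∧
      ((totalVariation φ).toReal < Real.pi →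
        LogWellDefined (Lexp φ) ∧
        spectralRadius ℂ (complexify (algLog (Lexp φ))) ≤ totalVariation φ) := by
  have h1 : ‖(1 : H →L[ℝ] H)‖ ≤ 1 := ContinuousLinearMap.norm_id_le
  have hspec := spectrum_map_Lexp_subset h1 φ hφ hatom
    (Complexification.extend (H := H)).toRingHom Complexification.norm_extend_apply_le
  refine ⟨conformalRange_subset_of_norm_log_le (fun _ _ => rfl)
    fun x hx => norm_log_conformalQuot_Lexp_le h1 φ hφ hatom (RingHom.id _)
      (fun a v => a.le_opNorm v) hx,
    Complexification.spectrum_complexify_subset _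
      (fun _ => Complex.conj_mem_exp_image_closedBall) hspec, fun hr => ?_⟩
  obtain ⟨hlog, hspec'⟩ := logWellDefined_and_spectrum_algLog_subset hr hspec
  -- Well-definedness must first descend to the real algebra, because `map_algLog` requires it
  -- there.
  have hlogR : LogWellDefined (Lexp φ) := fun t ht =>
    Complexification.isUnit_of_isUnit_extend (by
      rw [map_add, map_smul, map_smul, map_one]; exact hlog t ht)
  refine ⟨hlogR, spectralRadius_le_of_spectrum_subset_closedBall
    (Complexification.spectrum_complexify_subset _ (fun z hz => by simpa using hz) ?_)⟩
  rw [map_algLog _ Complexification.continuous_extend hlogR]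
  exact hspec'

end OperatorLexp

theorem mainTheorem1 (I : Set ℝ) (hI : I.OrdConnected) :
    -- complex Hilbert spaces
    (∀ (H : Type*) [NormedAddCommGroup H] [InnerProductSpace ℂ H] [CompleteSpace H]
        (φ : VectorMeasure I (H →L[ℂ] H)), totalVariation φ < ⊤ → (∀ t : I, φ {t} = 0) →
      conformalRange (Lexp φ) ⊆ Complex.exp '' Metric.closedBall 0 (totalVariation φ).toReal ∧
      spectrum ℂ (Lexp φ) ⊆ Complex.exp '' Metric.closedBall 0 (totalVariation φ).toReal ∧
      ((totalVariation φ).toReal < Real.pi →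
        LogWellDefined (Lexp φ) ∧
        spectralRadius ℂ (algLog (Lexp φ)) ≤ totalVariation φ)) ∧
    -- real Hilbert spaces, with spectra taken in the complexification
    (∀ (H : Type*) [NormedAddCommGroup H] [InnerProductSpace ℝ H] [CompleteSpace H]
        (φ : VectorMeasure I (H →L[ℝ] H)), totalVariation φ < ⊤ → (∀ t : I, φ {t} = 0) →
      conformalRange (Lexp φ) ⊆ Complex.exp '' Metric.closedBall 0 (totalVariation φ).toReal ∧
      spectrum ℂ (complexify (Lexp φ)) ⊆
        Complex.exp '' Metric.closedBall 0 (totalVariation φ).toReal ∧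
      ((totalVariation φ).toReal < Real.pi →
        LogWellDefined (Lexp φ) ∧
        spectralRadius ℂ (complexify (algLog (Lexp φ))) ≤ totalVariation φ)) :=
  ⟨fun _ _ _ _ φ hφ hatom => Lexp_complex φ hφ hatom,
    fun _ _ _ _ φ hφ hatom => Lexp_real φ hφ hatom⟩
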